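/- Let $D$ be a separable complex Hilbert space, $\mathbb D$ the open unit disc, $\mathbb T$ the unit circle, and let $B$ be in the Schur class $\mathcal S(D,\mathbb C)$, i.e. $B$ is analytic on $\mathbb D$ and each $B(z)$ is a contractive linear map $D\to\mathbb C$. Let $T_B:H^2(D)\to H^2$ be multiplication by $B$, where $H^2(E)$ is the space of power series on $\mathbb D$ with square summable coefficients in $E$ and $H^2=H^2(\mathbb C)$, and let $\mathcal H(B)\subseteq H^2$ be the de Branges–Rovnyak space, the range of $(I-T_BT_B^*)^{1/2}$. For a bounded linear functional $\xi$ on $D$ (a row vector), $B(z)\xi^*$ denotes the scalar obtained by composing $B(z)$ with the adjoint $\xi^*:\mathbb C\to D$ (in coordinates $\sum_i b_i(z)\overline{\xi_i}$). A function $g$ on $\mathbb D$ has a non-tangential limit $\ell\in\mathbb C$ at $\lambda\in\mathbb T$, written $\ell=\angle\lim_{z\to\lambda}g(z)$, if for every $\alpha>1$, $g(z)\to\ell$ as $z\to\lambda$ within $\{z\in\mathbb D:|z-\lambda|<\alpha(1-|z|)\}$. Let $\lambda\in\mathbb T$. Then the following are equivalent: (i) $\displaystyle\liminf_{z\to\lambda,\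 z\in\mathbb D}\frac{1-\|B(z)\|}{1-|z|}<+\infty$; (ii) there is $\xi$ with $\|\xi\|=1$ such that $z\mapsto\dfrac{1-B(z)\xi^*}{1-z\overline\lambda}$ belongs to $\mathcal H(B)$; (iii) every $f\in\mathcal H(B)$ has a non-tangential limit at $\lambda$; (iv) $B$ satisfies the Carathéodory condition at $\lambda$: there is $\xi$ with $\|\xi\|=1$ such that $\displaystyle\angle\lim_{z\to\lambda}\frac{1-B(z)\xi^*}{1-z\overline\lambda}$ exists (in $\mathbb C$). If moreover $B$ is not a constant function of norm one, then (i)–(iv) are also equivalent to (v) there is $\xi$ with $\|\xi\|=1$ such that $\mu_\xi(\{\lambda\})\ne0$, where $\mu_\xi$ is the Aleksandrov–Clark measure of $B$ associated with $\xi$, i.e. $1-B(z)\xi^*$ has no zero in $\mathbb D$ and $\mu_\xi$ is the positive finite Borel measure on $\mathbb T$ with $$\frac{1+B(z)\xi^*}{1-B(z)\xi^*}=\int_{\mathbb T}\frac{\zeta+z}{\zeta-z}\,d\mu_\xi(\zeta)+i\,\mathrm{Im}\,\frac{1+B(0)\xi^*}{1-B(0)\xi^*},\qquad z\in\mathbb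 D.$$ -/

import Mathlib

namespace Schur

open Complex in
theorem parseval_poly {E : Type*} [NormedAddCommGroup E] [InnerProductSpace ℂ E]
    (p : ℕ → E) (N : ℕ) (r : ℝ) :
    ∫ t in (0 : ℝ)..(2 * Real.pi), ‖∑ n ∈ Finset.range N, (circleMap 0 r t) ^ n • p n‖ ^ 2
      = 2 * Real.pi * ∑ n ∈ Finset.range N, r ^ (2 * n) * ‖p n‖ ^ 2 := by
  have hint : ∀ m n : ℕ, ∫ t in (0 : ℝ)..(2 * Real.pi),
      (starRingEnd ℂ) ((circleMap 0 r t) ^ m) * (circleMap 0 r t) ^ n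
        = if m = n then 2 * Real.pi * (r : ℂ) ^ (2 * n) else 0 := by
    intro m n
    have h1 : ∀ t : ℝ, (starRingEnd ℂ) ((circleMap 0 r t) ^ m) * (circleMap 0 r t) ^ n
        = (r : ℂ) ^ (m + n) * exp (((n : ℂ) - m) * I * t) := by
      intro t
      simp only [circleMap, zero_add, mul_pow, map_mul, map_pow, conj_ofReal, ← exp_conj, conj_I,
        ← exp_nat_mul, pow_add]
      rw [mul_mul_mul_comm, ← exp_add]
      simp only [map_natCast]
      congr 2
      ring
    simp_rw [h1]
    rw [intervalIntegral.integral_const_mul]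
    split_ifs with h
    · subst h
      simp [← two_mul, mul_comm]
    · have hne : ((n : ℂ) - m) * I ≠ 0 := by
        refine mul_ne_zero ?_ I_ne_zero
        rw [sub_ne_zero]
        exact_mod_cast Ne.symm h
      rw [integral_exp_mul_complex hne]
      have : exp (((n : ℂ) - m) * I * ((2 * Real.pi : ℝ) : ℂ)) = 1 := by
        rw [exp_eq_one_iff]
        exact ⟨(n : ℤ) - m, by push_cast; ring⟩
      rw [this]
      simp
  have key : ∫ t in (0 : ℝ)..(2 * Real.pi),
      ((‖∑ n ∈ Finset.range N, (circleMap 0 r t) ^ n • p n‖ ^ 2 : ℝ) : ℂ)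
      = 2 * Real.pi * ∑ n ∈ Finset.range N, (r : ℂ) ^ (2 * n) * (‖p n‖ : ℂ) ^ 2 := by
    have h2 : ∀ t : ℝ, ((‖∑ n ∈ Finset.range N, (circleMap 0 r t) ^ n • p n‖ ^ 2 : ℝ) : ℂ)
        = ∑ m ∈ Finset.range N, ∑ n ∈ Finset.range N,
          (starRingEnd ℂ) ((circleMap 0 r t) ^ m) * (circleMap 0 r t) ^ n * inner ℂ (p m) (p n) := by
      intro t
      have := inner_self_eq_norm_sq_to_K (𝕜 := ℂ) (∑ n ∈ Finset.range N, (circleMap 0 r t) ^ n • p n)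
      push_cast
      rw [show ((‖∑ n ∈ Finset.range N, (circleMap 0 r t) ^ n • p n‖ : ℝ) : ℂ) ^ 2 = _ from this.symm]
      simp only [sum_inner, inner_sum, inner_smul_left, inner_smul_right, Finset.mul_sum]
      rw [Finset.sum_comm]
      refine Finset.sum_congr rfl fun m _ => Finset.sum_congr rfl fun n _ => ?_
      ring
    have hc : ∀ m n : ℕ, Continuous fun t : ℝ =>
        (starRingEnd ℂ) ((circleMap 0 r t) ^ m) * (circleMap 0 r t) ^ n * inner ℂ (p m) (p n) := by
      intro m n
      have := continuous_circleMap 0 r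
      fun_prop
    simp_rw [h2]
    rw [intervalIntegral.integral_finsetSum
      (fun m _ => (continuous_finsetSum _ fun n _ => hc m n).intervalIntegrable _ _)]
    rw [Finset.mul_sum]
    refine Finset.sum_congr rfl fun m hm => ?_
    rw [intervalIntegral.integral_finsetSum (fun n _ => (hc m n).intervalIntegrable _ _)]
    simp_rw [intervalIntegral.integral_mul_const, hint]
    rw [Finset.sum_eq_single m]
    · have := inner_self_eq_norm_sq_to_K (𝕜 := ℂ) (p m)
      rw [this]
      simp [mul_assoc]
    · intro b _ hb
      simp [hb.symm]
    · intro h; exact absurd hm h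
  rw [intervalIntegral.integral_ofReal] at key
  exact_mod_cast key

section
variable {D : Type*} [NormedAddCommGroup D] [InnerProductSpace ℂ D]

theorem cauchy_hasSum (a : ℕ → D →L[ℂ] ℂ) (h : ℕ → D) (z : ℂ) (A : D →L[ℂ] ℂ) (H : D)
    (ha : HasSum (fun n => z ^ n • a n) A) (hh : HasSum (fun n => z ^ n • h n) H)
    (ha' : Summable fun n => ‖z ^ n • a n‖) (hh' : Summable fun n => ‖z ^ n • h n‖) :
    HasSum (fun n => z ^ n * ∑ k ∈ Finset.HasAntidiagonal.antidiagonal n, a k.1 (h k.2)) (A H) := by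
  have hs : Summable fun p : ℕ × ℕ => (z ^ p.1 • a p.1) (z ^ p.2 • h p.2) := by
    refine Summable.of_norm_bounded
      (ha'.mul_of_nonneg hh' (fun _ => norm_nonneg _) (fun _ => norm_nonneg _)) fun p => ?_
    exact (z ^ p.1 • a p.1).le_opNorm _
  have h1 : HasSum (fun p : ℕ × ℕ => (z ^ p.1 • a p.1) (z ^ p.2 • h p.2)) (A H) := by
    have e1 : ∀ k, HasSum (fun m => (z ^ k • a k) (z ^ m • h m)) ((z ^ k • a k) H) :=
      fun k => hh.mapL (z ^ k • a k)
    have e2 := hs.hasSum.prod_fiberwise e1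
    have e3 : HasSum (fun k => (z ^ k • a k) H) (A H) :=
      ha.mapL (ContinuousLinearMap.apply ℂ ℂ H)
    rw [← e2.unique e3]
    exact hs.hasSum
  rw [← (Finset.HasAntidiagonal.sigmaAntidiagonalEquivProd (A := ℕ)).hasSum_iff] at h1
  have h2 := h1.sigma (fun n => hasSum_fintype _)
  convert h2 using 2 with n
  rw [Finset.mul_sum, ← Finset.sum_coe_sort]
  refine Finset.sum_congr rfl fun k _ => ?_
  have : k.1.1 + k.1.2 = n := Finset.HasAntidiagonal.mem_antidiagonal.1 k.2
  simp [← this, pow_add]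
  ring

/-- The Schur class `S(D, ℂ)`: functions analytic on the open unit disc (values of `B` off the disc
are irrelevant) whose values there are contractive operators `D → ℂ`. -/
structure IsSchur (B : ℂ → D →L[ℂ] ℂ) : Prop where
  analytic : DifferentiableOn ℂ B (Metric.ball 0 1)
  contractive : ∀ z ∈ Metric.ball (0 : ℂ) 1, ‖B z‖ ≤ 1

/-- The `n`-th Taylor coefficient `Bₙ` of `B` at the origin. -/
noncomputable def taylorCoeff (B : ℂ → D →L[ℂ] ℂ) (n : ℕ) : D →L[ℂ] ℂ :=
  (n.factorial : ℂ)⁻¹ • iteratedDeriv n B 0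

theorem IsSchur.norm_coeff_le {B : ℂ → D →L[ℂ] ℂ} (hB : IsSchur B) (n : ℕ) :
    ‖taylorCoeff B n‖ ≤ 1 := by
  have h1 : ∀ R ∈ Set.Ioo (0 : ℝ) 1, R ^ n * ‖taylorCoeff B n‖ ≤ 1 := by
    intro R hR
    have hsub : Metric.closedBall (0 : ℂ) R ⊆ Metric.ball 0 1 :=
      Metric.closedBall_subset_ball hR.2
    have := Complex.norm_iteratedDeriv_le_of_forall_mem_sphere_norm_le n hR.1
      (hB.analytic.diffContOnCl_ball hsub)
      (fun z hz => hB.contractive z (hsub (Metric.sphere_subset_closedBall hz)))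
    rw [taylorCoeff, norm_smul, norm_inv, Complex.norm_natCast]
    have hn : (0 : ℝ) < n.factorial := by exact_mod_cast n.factorial_pos
    have hRn : 0 < R ^ n := pow_pos hR.1 n
    rw [le_div_iff₀ hRn] at this
    rw [← mul_le_mul_iff_right₀ hn]
    calc _ = ‖iteratedDeriv n B 0‖ * R ^ n := by field_simp
      _ ≤ _ := this
  have h2 : Filter.Tendsto (fun R : ℝ => R ^ n * ‖taylorCoeff B n‖) (nhdsWithin 1 (Set.Iio 1))
      (nhds (1 ^ n * ‖taylorCoeff B n‖)) := by
    refine (Continuous.tendsto ?_ 1).mono_left nhdsWithin_le_nhds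
    fun_prop
  rw [one_pow, one_mul] at h2
  refine le_of_tendsto h2 ?_
  filter_upwards [Ioo_mem_nhdsLT (show (0 : ℝ) < 1 by norm_num)] with R hR using h1 R hR

theorem IsSchur.hasSum {B : ℂ → D →L[ℂ] ℂ} (hB : IsSchur B) {z : ℂ} (hz : ‖z‖ < 1) :
    HasSum (fun n => z ^ n • taylorCoeff B n) (B z) := by
  have := Complex.hasSum_taylorSeries_on_ball hB.analytic (z := z) (by simpa using hz)
  have h2 : (fun n => z ^ n • taylorCoeff B n) =
      fun n => (n.factorial : ℂ)⁻¹ • (z - 0) ^ n • iteratedDeriv n B 0 := by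
    funext n
    rw [sub_zero, taylorCoeff, smul_comm]
  rw [h2]
  exact this

theorem summable_pow_smul {F : Type*} [NormedAddCommGroup F] [NormedSpace ℂ F] {f : ℕ → F} {K : ℝ}
    (hf : ∀ n, ‖f n‖ ≤ K) {z : ℂ} (hz : ‖z‖ < 1) : Summable fun n => ‖z ^ n • f n‖ := by
  refine Summable.of_nonneg_of_le (fun _ => norm_nonneg _) (fun n => ?_)
    ((summable_geometric_of_lt_one (norm_nonneg z) hz).mul_right K)
  rw [norm_smul, norm_pow]
  exact mul_le_mul_of_nonneg_left (hf n) (by positivity)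

/-- The `n`-th Taylor coefficient `∑_{k+m=n} Bₖ hₘ` of `z ↦ B(z) (∑ₘ hₘ zᵐ)`. -/
noncomputable def mulCoeff (B : ℂ → D →L[ℂ] ℂ) (h : ℕ → D) (n : ℕ) : ℂ :=
  ∑ k ∈ Finset.HasAntidiagonal.antidiagonal n, taylorCoeff B k.1 (h k.2)

theorem IsSchur.hasSum_mulCoeff {B : ℂ → D →L[ℂ] ℂ} (hB : IsSchur B) {h : ℕ → D} {K : ℝ}
    (hK : ∀ n, ‖h n‖ ≤ K) {z : ℂ} (hz : ‖z‖ < 1) {H : D} (hH : HasSum (fun n => z ^ n • h n) H) :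
    HasSum (fun n => z ^ n * mulCoeff B h n) (B z H) :=
  cauchy_hasSum _ _ z _ _ (hB.hasSum hz) hH (summable_pow_smul hB.norm_coeff_le hz)
    (summable_pow_smul hK hz)

theorem IsSchur.sum_mulCoeff_le {B : ℂ → D →L[ℂ] ℂ} (hB : IsSchur B) (h : ℕ → D) (N : ℕ) :
    ∑ n ∈ Finset.range N, ‖mulCoeff B h n‖ ^ 2 ≤ ∑ n ∈ Finset.range N, ‖h n‖ ^ 2 := by
  set h' : ℕ → D := fun n => if n < N then h n else 0 with hh'
  have hP : ∀ z : ℂ, HasSum (fun n => z ^ n • h' n) (∑ n ∈ Finset.range N, z ^ n • h n) := by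
    intro z
    have : ∑ n ∈ Finset.range N, z ^ n • h n = ∑ n ∈ Finset.range N, z ^ n • h' n :=
      Finset.sum_congr rfl fun n hn => by simp [hh', Finset.mem_range.1 hn]
    rw [this]
    refine hasSum_sum_of_ne_finset_zero fun n hn => ?_
    simp [hh', Finset.mem_range.not.1 hn]
  set K : ℝ := ∑ n ∈ Finset.range N, ‖h n‖ with hKdef
  have hK0 : 0 ≤ K := Finset.sum_nonneg fun _ _ => norm_nonneg _
  have hK : ∀ n, ‖h' n‖ ≤ K := by
    intro n
    by_cases hn : n < N
    · simp only [hh', hn, if_true]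
      exact Finset.single_le_sum (f := fun n => ‖h n‖) (fun _ _ => norm_nonneg _)
        (Finset.mem_range.2 hn)
    · simpa [hh', hn] using hK0
  have hc : ∀ n < N, mulCoeff B h n = mulCoeff B h' n := by
    intro n hn
    refine Finset.sum_congr rfl fun k hk => ?_
    have : k.2 < N := lt_of_le_of_lt (Finset.HasAntidiagonal.mem_antidiagonal.1 hk ▸ Nat.le_add_left _ _) hn
    simp [hh', this]
  set c := mulCoeff B h' with hcdef
  have main : ∀ r ∈ Set.Ioo (0 : ℝ) 1,
      ∑ n ∈ Finset.range N, r ^ (2 * n) * ‖c n‖ ^ 2 ≤ ∑ n ∈ Finset.range N, ‖h n‖ ^ 2 := by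
    intro r hr
    have hw : ∀ t, ‖circleMap 0 r t‖ = r := fun t => by simp [abs_of_pos hr.1]
    have hw1 : ∀ t, ‖circleMap 0 r t‖ < 1 := fun t => (hw t).trans_lt hr.2
    have hwb : ∀ t, circleMap 0 r t ∈ Metric.ball (0 : ℂ) 1 := fun t => by simpa using hw1 t
    have hcs : Summable fun n => r ^ n * ‖c n‖ := by
      have hz : ‖(r : ℂ)‖ < 1 := by simpa [abs_of_pos hr.1] using hr.2
      obtain ⟨s, hs1, hs2⟩ := exists_between hr.2
      have hz' : ‖(s : ℂ)‖ < 1 := by simpa [abs_of_pos (hr.1.trans hs1)] using hs2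
      have hb := (hB.hasSum_mulCoeff hK hz' (hP s)).summable.tendsto_atTop_zero
      obtain ⟨C, hC⟩ := (Metric.isBounded_range_of_tendsto _ hb).exists_norm_le
      have hs0 : 0 < s := hr.1.trans hs1
      refine Summable.of_nonneg_of_le (fun n => by have := hr.1.le; positivity) (fun n => ?_)
        ((summable_geometric_of_lt_one (div_nonneg hr.1.le hs0.le)
          ((div_lt_one hs0).2 hs1)).mul_right C)
      have := hC _ ⟨n, rfl⟩
      rw [norm_mul, norm_pow, Complex.norm_real, Real.norm_of_nonneg hs0.le] at this
      calc r ^ n * ‖c n‖ = (r / s) ^ n * (s ^ n * ‖c n‖) := by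
            rw [div_pow]; field_simp
        _ ≤ _ := mul_le_mul_of_nonneg_left this (by have := hr.1.le; positivity)
    set S := ∑' n, r ^ n * ‖c n‖
    have hlim : Filter.Tendsto (fun M : ℕ => ∫ t in (0 : ℝ)..(2 * Real.pi),
        ‖∑ n ∈ Finset.range M, (circleMap 0 r t) ^ n • c n‖ ^ 2) Filter.atTop
        (nhds (∫ t in (0 : ℝ)..(2 * Real.pi),
          ‖B (circleMap 0 r t) (∑ n ∈ Finset.range N, (circleMap 0 r t) ^ n • h n)‖ ^ 2)) := by
      refine intervalIntegral.tendsto_integral_filter_of_dominated_convergence (fun _ => S ^ 2)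
        ?_ ?_ ?_ ?_
      · refine Filter.Eventually.of_forall fun M => Continuous.aestronglyMeasurable ?_
        have := continuous_circleMap 0 r
        fun_prop
      · refine Filter.Eventually.of_forall fun M => Filter.Eventually.of_forall fun t _ => ?_
        rw [norm_pow, norm_norm]
        refine pow_le_pow_left₀ (norm_nonneg _) ?_ 2
        refine (norm_sum_le _ _).trans ?_
        simp only [norm_smul, norm_pow, hw]
        exact hcs.sum_le_tsum _ fun n _ => by have := hr.1.le; positivity
      · exact intervalIntegrable_const
      · refine Filter.Eventually.of_forall fun t _ => ?_
        exact ((hB.hasSum_mulCoeff hK (hw1 t) (hP _)).tendsto_sum_nat.norm).pow 2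
    have hle : 2 * Real.pi * ∑ n ∈ Finset.range N, r ^ (2 * n) * ‖c n‖ ^ 2 ≤
        ∫ t in (0 : ℝ)..(2 * Real.pi),
          ‖B (circleMap 0 r t) (∑ n ∈ Finset.range N, (circleMap 0 r t) ^ n • h n)‖ ^ 2 := by
      refine ge_of_tendsto hlim ?_
      filter_upwards [Filter.eventually_ge_atTop N] with M hM
      rw [parseval_poly]
      refine mul_le_mul_of_nonneg_left ?_ (by positivity)
      exact Finset.sum_le_sum_of_subset_of_nonneg (Finset.range_mono hM)
        fun n _ _ => by have := hr.1.le; positivity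
    have hPc : Continuous fun t : ℝ => ∑ n ∈ Finset.range N, (circleMap 0 r t) ^ n • h n := by
      have := continuous_circleMap 0 r
      fun_prop
    have hBc : Continuous fun t : ℝ => B (circleMap 0 r t) :=
      hB.analytic.continuousOn.comp_continuous (continuous_circleMap 0 r) hwb
    have hle2 : (∫ t in (0 : ℝ)..(2 * Real.pi),
          ‖B (circleMap 0 r t) (∑ n ∈ Finset.range N, (circleMap 0 r t) ^ n • h n)‖ ^ 2) ≤
        ∫ t in (0 : ℝ)..(2 * Real.pi), ‖∑ n ∈ Finset.range N, (circleMap 0 r t) ^ n • h n‖ ^ 2 := by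
      refine intervalIntegral.integral_mono_on (by positivity)
        (((hBc.clm_apply hPc).norm.pow 2).intervalIntegrable _ _)
        ((hPc.norm.pow 2).intervalIntegrable _ _) fun t _ => ?_
      refine pow_le_pow_left₀ (norm_nonneg _) ?_ 2
      refine ((B (circleMap 0 r t)).le_opNorm _).trans ?_
      exact mul_le_of_le_one_left (norm_nonneg _) (hB.contractive _ (hwb t))
    rw [parseval_poly] at hle2
    have := le_of_mul_le_mul_left (hle.trans hle2) (by positivity)
    refine this.trans (Finset.sum_le_sum fun n _ => ?_)
    exact mul_le_of_le_one_left (by positivity) (pow_le_one₀ hr.1.le hr.2.le)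
  have h2 : Filter.Tendsto (fun r : ℝ => ∑ n ∈ Finset.range N, r ^ (2 * n) * ‖c n‖ ^ 2)
      (nhdsWithin 1 (Set.Iio 1))
      (nhds (∑ n ∈ Finset.range N, 1 ^ (2 * n) * ‖c n‖ ^ 2)) := by
    refine (Continuous.tendsto ?_ 1).mono_left nhdsWithin_le_nhds
    fun_prop
  have h3 := le_of_tendsto h2 (by
    filter_upwards [Ioo_mem_nhdsLT (show (0 : ℝ) < 1 by norm_num)] with r hr using main r hr)
  simp only [one_pow, one_mul] at h3
  calc _ = ∑ n ∈ Finset.range N, ‖c n‖ ^ 2 :=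
        Finset.sum_congr rfl fun n hn => by rw [hc n (Finset.mem_range.1 hn)]
    _ ≤ _ := h3

/-- The Hardy space `H²(E)` of square summable power series with coefficients in `E`; an element is
its sequence of coefficients. -/
abbrev Hardy (E : Type*) [NormedAddCommGroup E] : Type _ := lp (fun _ : ℕ => E) 2

/-- The value at `z` of the power series `f`. -/
noncomputable def Hardy.eval {E : Type*} [NormedAddCommGroup E] [InnerProductSpace ℂ E]
    (f : Hardy E) (z : ℂ) : E :=
  ∑' n, z ^ n • f n

theorem Hardy.hasSum_eval {E : Type*} [NormedAddCommGroup E] [InnerProductSpace ℂ E]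
    [CompleteSpace E] (f : Hardy E) {z : ℂ} (hz : ‖z‖ < 1) :
    HasSum (fun n => z ^ n • f n) (f.eval z) :=
  (summable_pow_smul (fun n => lp.norm_apply_le_norm (by norm_num) f n) hz).of_norm.hasSum

theorem IsSchur.sum_finset_mulCoeff_le {B : ℂ → D →L[ℂ] ℂ} (hB : IsSchur B) (h : Hardy D)
    (s : Finset ℕ) :
    ∑ n ∈ s, ‖mulCoeff B h n‖ ^ (2 : ENNReal).toReal ≤ ‖h‖ ^ (2 : ENNReal).toReal := by
  obtain ⟨N, hN⟩ := s.exists_nat_subset_range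
  have h1 := lp.sum_rpow_le_norm_rpow (p := 2) (by norm_num) h (Finset.range N)
  simp only [ENNReal.toReal_ofNat, Real.rpow_ofNat] at h1 ⊢
  calc ∑ n ∈ s, ‖mulCoeff B h n‖ ^ 2 ≤ ∑ n ∈ Finset.range N, ‖mulCoeff B h n‖ ^ 2 :=
        Finset.sum_le_sum_of_subset_of_nonneg hN fun _ _ _ => by positivity
    _ ≤ _ := (hB.sum_mulCoeff_le h N).trans h1

/-- The operator `T_B : H²(D) → H²` of multiplication by the Schur function `B`. -/
noncomputable def IsSchur.mulOp {B : ℂ → D →L[ℂ] ℂ} (hB : IsSchur B) : Hardy D →L[ℂ] Hardy ℂ :=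
  LinearMap.mkContinuous
    { toFun := fun h => ⟨mulCoeff B h, memℓp_gen' (hB.sum_finset_mulCoeff_le h)⟩
      map_add' := fun f g => by
        ext n
        change mulCoeff B (f + g) n = mulCoeff B f n + mulCoeff B g n
        simp [mulCoeff, Finset.sum_add_distrib]
      map_smul' := fun c f => by
        ext n
        change mulCoeff B (c • f) n = c * mulCoeff B f n
        simp [mulCoeff, Finset.mul_sum] }
    1 fun h => by
      rw [one_mul]
      exact lp.norm_le_of_forall_sum_le (by norm_num) (norm_nonneg _)
        (hB.sum_finset_mulCoeff_le h)

/-- `T_B` is pointwise multiplication by `B` on the unit disc. -/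
theorem IsSchur.eval_mulOp [CompleteSpace D] {B : ℂ → D →L[ℂ] ℂ} (hB : IsSchur B) (h : Hardy D)
    {z : ℂ} (hz : ‖z‖ < 1) : (hB.mulOp h).eval z = B z (h.eval z) :=
  (hB.hasSum_mulCoeff (fun n => lp.norm_apply_le_norm (by norm_num) h n) hz
    (h.hasSum_eval hz)).tsum_eq

/-- `T_B` is a contraction. -/
theorem IsSchur.norm_mulOp_le {B : ℂ → D →L[ℂ] ℂ} (hB : IsSchur B) : ‖hB.mulOp‖ ≤ 1 :=
  LinearMap.mkContinuous_norm_le _ zero_le_one _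

/-- The de Branges–Rovnyak space `H(A)` of a contraction `A : H → K` as a linear subspace of `K`: the
range of the defect operator `(I - A A*)^{1/2}`. -/
noncomputable def deBrangesRovnyak {H K : Type*} [NormedAddCommGroup H] [InnerProductSpace ℂ H]
    [CompleteSpace H] [NormedAddCommGroup K] [InnerProductSpace ℂ K] [CompleteSpace K]
    (A : H →L[ℂ] K) : Submodule ℂ K :=
  LinearMap.range (CFC.sqrt (1 - A ∘L ContinuousLinearMap.adjoint A) : K →L[ℂ] K).toLinearMap

variable [CompleteSpace D]

/-- The function `g` on the unit disc belongs to `H(B) = H(T_B)`. -/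
def IsSchur.MemH {B : ℂ → D →L[ℂ] ℂ} (hB : IsSchur B) (g : ℂ → ℂ) : Prop :=
  ∃ f ∈ deBrangesRovnyak hB.mulOp, ∀ z ∈ Metric.ball (0 : ℂ) 1, g z = f.eval z

/-- `B(z) ξ*` for a row vector `ξ`, i.e. a bounded functional `ξ : D → ℂ`; in coordinates,
`∑ᵢ bᵢ(z) \overline{ξᵢ}`. -/
noncomputable def mulStar (B : ℂ → D →L[ℂ] ℂ) (ξ : D →L[ℂ] ℂ) (z : ℂ) : ℂ :=
  (B z ∘L ContinuousLinearMap.adjoint ξ) 1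

/-- The non-tangential approach region `Γ_α(lam)`. -/
def approachRegion (α : ℝ) (lam : ℂ) : Set ℂ :=
  {z | ‖z‖ < 1 ∧ ‖z - lam‖ < α * (1 - ‖z‖)}

/-- `g` has the (finite) non-tangential limit `l` at `lam`. -/
def HasNontangentialLimit (g : ℂ → ℂ) (lam l : ℂ) : Prop :=
  ∀ α : ℝ, 1 < α → Filter.Tendsto g (nhdsWithin lam (approachRegion α lam)) (nhds l)

/-- `B` satisfies the Carathéodory condition at `lam`. -/
def CaratheodoryCondition (B : ℂ → D →L[ℂ] ℂ) (lam : ℂ) : Prop :=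
  ∃ ξ : D →L[ℂ] ℂ, ‖ξ‖ = 1 ∧
    ∃ l : ℂ, HasNontangentialLimit
      (fun z => (1 - mulStar B ξ z) / (1 - z * starRingEnd ℂ lam)) lam l

/-- The function `H_ξ = (1 + B ξ*) / (1 - B ξ*)`. -/
noncomputable def herglotz (B : ℂ → D →L[ℂ] ℂ) (ξ : D →L[ℂ] ℂ) (z : ℂ) : ℂ :=
  (1 + mulStar B ξ z) / (1 - mulStar B ξ z)

/-- `μ` is the Aleksandrov–Clark measure of `B` associated with `ξ`: the positive finite Borel
measure on the unit circle representing `H_ξ`. The condition `ne_one` says that `H_ξ` is defined on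
the unit disc; it fails only if `B` is the constant `ξ`, with `ξ` of norm one. -/
structure IsAleksandrovClark (B : ℂ → D →L[ℂ] ℂ) (ξ : D →L[ℂ] ℂ)
    (μ : MeasureTheory.Measure (Metric.sphere (0 : ℂ) 1)) : Prop where
  finite : MeasureTheory.IsFiniteMeasure μ
  ne_one : ∀ z ∈ Metric.ball (0 : ℂ) 1, mulStar B ξ z ≠ 1
  representation : ∀ z ∈ Metric.ball (0 : ℂ) 1,
    herglotz B ξ z = (∫ ζ, ((ζ : ℂ) + z) / ((ζ : ℂ) - z) ∂μ) + Complex.I * ((herglotz B ξ 0).im : ℂ)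

end

end Schur

namespace Schur

/-! ### Szegő kernels, the defect operator and the reproducing kernel of H(B). -/

section
open scoped InnerProductSpace
open Filter Topology

variable {E : Type*} [NormedAddCommGroup E] [InnerProductSpace ℂ E]

/-! Write Δ for the defect operator of T_B and k_w for Δ applied to the Szegő kernel at w. Elements
of H(B) are exactly the functions z ↦ ⟪k_z, v⟫ with v in H² (`IsSchur.memH_iff`), and ⟪k_z, k_w⟫ =
(1 - B(z)B(w)*) / (1 - z w̄). Hence ‖k_w‖² = (1 - ‖B(w)‖²) / (1 - |w|²) is comparable with the
quotient in (i), which thus measures the growth of point evaluations near λ.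

If k_w stays bounded along some approach to λ, weak limits u of k_w and b of B(w)* exist, and u
represents the quotient in (ii) (`IsSchur.exists_quotient_memH`). Conversely, such a u keeps k_w
bounded in every approach region and forces B(w)* → b in norm, so k_w converges weakly modulo
vectors representing the zero function; this is (iii) (`IsSchur.exists_nontangentialLimit`).
Applying (iii) to the quotient itself gives (iv), and (iv) on the radius gives (i). Uniform
boundedness gives (iii) → (i).

For (v), the Herglotz theorem provides μ_ξ, and (1 - r) H_ξ(rλ) → 2 μ_ξ({λ}). Multiplying this by
the difference quotient of Bξ* gives 1 + Bξ*, so a finite limit of the quotient and a point mass at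
λ control each other. -/

theorem memlp_szegoKernel {w : ℂ} (hw : ‖w‖ < 1) (d : E) :
    Memℓp (fun n : ℕ => starRingEnd ℂ w ^ n • d) 2 := by
  refine memℓp_gen ?_
  have h : (fun n : ℕ => ‖starRingEnd ℂ w ^ n • d‖ ^ (2 : ENNReal).toReal)
      = fun n => (‖w‖ ^ 2) ^ n * ‖d‖ ^ 2 := by
    funext n
    simp only [ENNReal.toReal_ofNat, Real.rpow_ofNat, norm_smul, norm_pow, RCLike.norm_conj]
    ring
  rw [h]
  exact (summable_geometric_of_lt_one (by positivity)
    (pow_lt_one₀ (norm_nonneg _) hw two_ne_zero)).mul_right _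

/-- The Szegő kernel `z ↦ d / (1 - z \bar w)` of `H²(E)` at the point `w` in the direction `d`
(the zero function when `w` is not in the unit disc). -/
noncomputable def szegoKernel (w : ℂ) (d : E) : Hardy E :=
  open Classical in
  if hw : ‖w‖ < 1 then ⟨fun n => starRingEnd ℂ w ^ n • d, memlp_szegoKernel hw d⟩ else 0

theorem szegoKernel_apply {w : ℂ} (hw : ‖w‖ < 1) (d : E) (n : ℕ) :
    szegoKernel w d n = starRingEnd ℂ w ^ n • d := by
  simp [szegoKernel, hw]

/-- The inner product is conjugate linear in its first slot, so the coefficients w̄ⁿ of the kernel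
turn into wⁿ: the reproducing property. -/
theorem inner_szegoKernel [CompleteSpace E] {w : ℂ} (hw : ‖w‖ < 1) (d : E) (h : Hardy E) :
    ⟪szegoKernel w d, h⟫_ℂ = ⟪d, h.eval w⟫_ℂ := by
  refine (lp.hasSum_inner (szegoKernel w d) h).unique ?_
  have h1 := (h.hasSum_eval hw).mapL (innerSL ℂ d)
  simp only [innerSL_apply_apply] at h1
  convert h1 using 2 with n
  rw [szegoKernel_apply hw, inner_smul_left, inner_smul_right]
  simp

theorem one_sub_mul_conj_ne_zero {z w : ℂ} (hz : ‖z‖ < 1) (hw : ‖w‖ ≤ 1) :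
    1 - z * starRingEnd ℂ w ≠ 0 := by
  intro h
  have h1 : ‖z * starRingEnd ℂ w‖ = 1 := by rw [← sub_eq_zero.1 h, norm_one]
  rw [norm_mul, RCLike.norm_conj] at h1
  nlinarith [norm_nonneg z, norm_nonneg w]

theorem eval_szegoKernel [CompleteSpace E] {z w : ℂ} (hz : ‖z‖ < 1) (hw : ‖w‖ < 1) (d : E) :
    (szegoKernel w d).eval z = (1 - z * starRingEnd ℂ w)⁻¹ • d := by
  refine ((szegoKernel w d).hasSum_eval hz).unique ?_
  have h : ‖z * starRingEnd ℂ w‖ < 1 := by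
    rw [norm_mul, RCLike.norm_conj]
    nlinarith [norm_nonneg z, norm_nonneg w]
  convert (hasSum_geometric_of_norm_lt_one h).smul_const d using 2 with n
  rw [szegoKernel_apply hw, smul_smul, mul_pow]

theorem Hardy.eval_sub [CompleteSpace E] (f g : Hardy E) {z : ℂ} (hz : ‖z‖ < 1) :
    (f - g).eval z = f.eval z - g.eval z := by
  refine ((f - g).hasSum_eval hz).unique ?_
  simpa [smul_sub] using (f.hasSum_eval hz).sub (g.hasSum_eval hz)

theorem Hardy.eval_eq_inner (f : Hardy ℂ) {w : ℂ} (hw : ‖w‖ < 1) :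
    f.eval w = ⟪szegoKernel w (1 : ℂ), f⟫_ℂ := by
  rw [inner_szegoKernel hw]
  simp

/-- The defect operator of a contraction. -/
noncomputable abbrev defect {H K : Type*} [NormedAddCommGroup H] [InnerProductSpace ℂ H]
    [CompleteSpace H] [NormedAddCommGroup K] [InnerProductSpace ℂ K] [CompleteSpace K]
    (A : H →L[ℂ] K) : K →L[ℂ] K :=
  CFC.sqrt (1 - A ∘L ContinuousLinearMap.adjoint A)

section
variable {H K : Type*} [NormedAddCommGroup H] [InnerProductSpace ℂ H]
    [CompleteSpace H] [NormedAddCommGroup K] [InnerProductSpace ℂ K] [CompleteSpace K]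
    {A : H →L[ℂ] K}

theorem inner_defect_left (x y : K) : ⟪defect A x, y⟫_ℂ = ⟪x, defect A y⟫_ℂ := by
  have h : IsSelfAdjoint (defect A) := IsSelfAdjoint.of_nonneg (CFC.sqrt_nonneg _)
  rw [← ContinuousLinearMap.adjoint_inner_left, ContinuousLinearMap.isSelfAdjoint_iff'.1 h]

/-- The square root squares back only for a positive operator; here ⟪(1 - AA*)x, x⟫ = ‖x‖² - ‖A*x‖²
≥ 0 because A is a contraction. -/
theorem defect_defect (hA : ‖A‖ ≤ 1) (x : K) :
    defect A (defect A x) = x - A (ContinuousLinearMap.adjoint A x) := by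
  have h : (0 : K →L[ℂ] K) ≤ 1 - A ∘L ContinuousLinearMap.adjoint A := by
    rw [ContinuousLinearMap.nonneg_iff_isPositive, ContinuousLinearMap.isPositive_iff_complex]
    intro x
    have h1 : ⟪(1 - A ∘L ContinuousLinearMap.adjoint A) x, x⟫_ℂ
        = ((‖x‖ ^ 2 - ‖ContinuousLinearMap.adjoint A x‖ ^ 2 : ℝ) : ℂ) := by
      simp only [sub_apply, one_apply_eq_self,
        ContinuousLinearMap.comp_apply, inner_sub_left]
      rw [← ContinuousLinearMap.adjoint_inner_right, inner_self_eq_norm_sq_to_K,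
        inner_self_eq_norm_sq_to_K]
      push_cast
      rfl
    rw [h1]
    rw [RCLike.re_eq_complex_re, Complex.ofReal_re]
    refine ⟨rfl, ?_⟩
    have h2 : ‖ContinuousLinearMap.adjoint A x‖ ≤ ‖x‖ := by
      refine (ContinuousLinearMap.le_opNorm _ _).trans ?_
      rw [LinearIsometryEquiv.norm_map]
      exact mul_le_of_le_one_left (norm_nonneg _) hA
    have h3 := pow_le_pow_left₀ (norm_nonneg _) h2 2
    linarith
  have h1 := CFC.sqrt_mul_sqrt_self _ h
  have h2 := DFunLike.congr_fun h1 x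
  simpa using h2

end

variable {D : Type*} [NormedAddCommGroup D] [InnerProductSpace ℂ D] [CompleteSpace D]
  {B : ℂ → D →L[ℂ] ℂ}

/-- The vector `φ^* 1` representing the functional `φ`. -/
noncomputable abbrev rep (φ : D →L[ℂ] ℂ) : D := ContinuousLinearMap.adjoint φ 1

theorem inner_rep (φ : D →L[ℂ] ℂ) (x : D) : ⟪rep φ, x⟫_ℂ = φ x := by
  rw [ContinuousLinearMap.adjoint_inner_left]
  simp

theorem norm_rep (φ : D →L[ℂ] ℂ) : ‖rep φ‖ = ‖φ‖ := by
  have h : (InnerProductSpace.toDual ℂ D).symm φ = rep φ :=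
    ext_inner_right ℂ fun x => by rw [InnerProductSpace.toDual_symm_apply, inner_rep]
  rw [← h, LinearIsometryEquiv.norm_map]

theorem rep_surjective (b : D) : ∃ φ : D →L[ℂ] ℂ, rep φ = b :=
  ⟨innerSL ℂ b, ext_inner_right ℂ fun x => by rw [inner_rep, innerSL_apply_apply]⟩

theorem mulStar_eq (B : ℂ → D →L[ℂ] ℂ) (ξ : D →L[ℂ] ℂ) (z : ℂ) :
    mulStar B ξ z = B z (rep ξ) := rfl

theorem IsSchur.adjoint_mulOp_szegoKernel (hB : IsSchur B) {w : ℂ} (hw : ‖w‖ < 1) :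
    ContinuousLinearMap.adjoint hB.mulOp (szegoKernel w (1 : ℂ)) = szegoKernel w (rep (B w)) := by
  refine ext_inner_right ℂ fun h => ?_
  rw [ContinuousLinearMap.adjoint_inner_left, inner_szegoKernel hw, inner_szegoKernel hw,
    hB.eval_mulOp h hw, inner_rep]
  simp

theorem IsSchur.eval_defect_defect (hB : IsSchur B) {z w : ℂ} (hz : ‖z‖ < 1) (hw : ‖w‖ < 1) :
    (defect hB.mulOp (defect hB.mulOp (szegoKernel w (1 : ℂ)))).eval z
      = (1 - B z (rep (B w))) / (1 - z * starRingEnd ℂ w) := by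
  rw [defect_defect hB.norm_mulOp_le, Hardy.eval_sub _ _ hz, hB.adjoint_mulOp_szegoKernel hw,
    hB.eval_mulOp _ hz, eval_szegoKernel hz hw, eval_szegoKernel hz hw, map_smul]
  simp only [smul_eq_mul]
  ring

/-- The image under the defect operator of the Szegő kernel at `w`; it represents the evaluation at
`w` of the elements of `H(B)`. -/
noncomputable def IsSchur.kernel (hB : IsSchur B) (w : ℂ) : Hardy ℂ :=
  defect hB.mulOp (szegoKernel w (1 : ℂ))

theorem IsSchur.eval_defect (hB : IsSchur B) {w : ℂ} (hw : ‖w‖ < 1) (v : Hardy ℂ) :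
    (defect hB.mulOp v).eval w = ⟪hB.kernel w, v⟫_ℂ := by
  rw [Hardy.eval_eq_inner _ hw, IsSchur.kernel, inner_defect_left]

theorem IsSchur.inner_kernel_kernel (hB : IsSchur B) {z w : ℂ} (hz : ‖z‖ < 1) (hw : ‖w‖ < 1) :
    ⟪hB.kernel z, hB.kernel w⟫_ℂ = (1 - B z (rep (B w))) / (1 - z * starRingEnd ℂ w) := by
  rw [← hB.eval_defect hz, IsSchur.kernel, hB.eval_defect_defect hz hw]

theorem IsSchur.norm_kernel_sq (hB : IsSchur B) {w : ℂ} (hw : ‖w‖ < 1) :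
    ‖hB.kernel w‖ ^ 2 = (1 - ‖B w‖ ^ 2) / (1 - ‖w‖ ^ 2) := by
  have h := hB.inner_kernel_kernel hw hw
  rw [← inner_rep, inner_self_eq_norm_sq_to_K, inner_self_eq_norm_sq_to_K, norm_rep,
    RCLike.mul_conj] at h
  apply Complex.ofReal_injective
  push_cast
  exact h

/-- This is the only description of H(B) used from here on. The vector v lives in H² itself, so no
separate norm on H(B) is needed; v is unique only modulo vectors orthogonal to all kernels. -/
theorem IsSchur.memH_iff (hB : IsSchur B) (g : ℂ → ℂ) :
    hB.MemH g ↔ ∃ v : Hardy ℂ, ∀ z : ℂ, ‖z‖ < 1 → g z = ⟪hB.kernel z, v⟫_ℂ := by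
  constructor
  · rintro ⟨f, ⟨v, rfl⟩, hf⟩
    exact ⟨v, fun z hz => (hf z (by simpa using hz)).trans (hB.eval_defect hz v)⟩
  · rintro ⟨v, hv⟩
    refine ⟨_, ⟨v, rfl⟩, fun z hz => ?_⟩
    have hz' : ‖z‖ < 1 := by simpa using hz
    exact (hv z hz').trans (hB.eval_defect hz' v).symm

end

/-! ### Kernels near a boundary point and the equivalence of (i)–(iv). -/

section
open scoped InnerProductSpace
open Filter Topology

/-- Banach–Alaoglu transported through the Riesz isomorphism; an ultrafilter replaces the extraction
of subsequences. -/
theorem exists_tendsto_inner_ultrafilter {ι H : Type*} [NormedAddCommGroup H]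
    [InnerProductSpace ℂ H] [CompleteSpace H] (U : Ultrafilter ι) {x : ι → H} {C : ℝ}
    (hx : ∀ᶠ i in (U : Filter ι), ‖x i‖ ≤ C) :
    ∃ y : H, ‖y‖ ≤ C ∧ ∀ v : H, Tendsto (fun i => ⟪x i, v⟫_ℂ) U (𝓝 ⟪y, v⟫_ℂ) := by
  let f : ι → WeakDual ℂ H := fun i =>
    StrongDual.toWeakDual (InnerProductSpace.toDual ℂ H (x i))
  have hc := WeakDual.isCompact_closedBall (𝕜 := ℂ) (0 : StrongDual ℂ H) C
  have hU : ((U.map f : Ultrafilter _) : Filter (WeakDual ℂ H)) ≤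
      𝓟 (WeakDual.toStrongDual ⁻¹' Metric.closedBall (0 : StrongDual ℂ H) C) := by
    rw [le_principal_iff, Ultrafilter.coe_map, mem_map]
    filter_upwards [hx] with i hi
    simpa [f] using hi
  obtain ⟨φ, hφ, hlim⟩ := hc.ultrafilter_le_nhds _ hU
  refine ⟨(InnerProductSpace.toDual ℂ H).symm (WeakDual.toStrongDual φ), ?_, fun v => ?_⟩
  · simpa using hφ
  · rw [InnerProductSpace.toDual_symm_apply]
    exact ((WeakDual.eval_continuous v).tendsto φ).comp hlim

theorem mem_ball_of_mem_approachRegion {α : ℝ} {lam z : ℂ} (hz : z ∈ approachRegion α lam) :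
    z ∈ Metric.ball (0 : ℂ) 1 := by
  simpa using hz.1

theorem tendsto_radius_approachRegion {lam : ℂ} (hlam : ‖lam‖ = 1) {α : ℝ} (hα : 1 < α) :
    Tendsto (fun r : ℝ => (r : ℂ) * lam) (𝓝[<] 1) (𝓝[approachRegion α lam] lam) := by
  refine tendsto_nhdsWithin_iff.2 ⟨?_, ?_⟩
  · have : Continuous fun r : ℝ => (r : ℂ) * lam := by fun_prop
    simpa using (this.tendsto 1).mono_left nhdsWithin_le_nhds
  · filter_upwards [Ioo_mem_nhdsLT (show (0 : ℝ) < 1 by norm_num)] with r hr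
    have h1 : ‖(r : ℂ) * lam‖ = r := by simp [hlam, abs_of_pos hr.1]
    have h2 : ‖(r : ℂ) * lam - lam‖ = 1 - r := by
      rw [show (r : ℂ) * lam - lam = ((r - 1 : ℝ) : ℂ) * lam by push_cast; ring, norm_mul, hlam,
        Complex.norm_real, mul_one, Real.norm_eq_abs, abs_of_neg (by linarith [hr.2])]
      ring
    refine ⟨h1.trans_lt hr.2, ?_⟩
    rw [h1, h2]
    nlinarith [hr.2]

theorem tendsto_radius_ball {lam : ℂ} (hlam : ‖lam‖ = 1) :
    Tendsto (fun r : ℝ => (r : ℂ) * lam) (𝓝[<] 1) (𝓝[Metric.ball 0 1] lam) :=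
  (tendsto_radius_approachRegion hlam one_lt_two).mono_right
    (nhdsWithin_mono _ fun _ => mem_ball_of_mem_approachRegion)

theorem norm_one_sub_mul_conj {lam : ℂ} (hlam : ‖lam‖ = 1) (z : ℂ) :
    ‖1 - z * starRingEnd ℂ lam‖ = ‖z - lam‖ := by
  have h : lam * starRingEnd ℂ lam = 1 := by rw [RCLike.mul_conj, hlam]; simp
  rw [← h, ← sub_mul, norm_mul, RCLike.norm_conj, hlam, mul_one, norm_sub_rev]

theorem one_sub_radius_mul_conj {lam : ℂ} (hlam : ‖lam‖ = 1) (r : ℝ) :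
    1 - (r : ℂ) * lam * starRingEnd ℂ lam = ((1 - r : ℝ) : ℂ) := by
  rw [mul_assoc, RCLike.mul_conj, hlam]; simp

variable {D : Type*} [NormedAddCommGroup D] [InnerProductSpace ℂ D]
  {B : ℂ → D →L[ℂ] ℂ} {lam : ℂ}

/-- The Julia quotient of `B` is bounded along some approach to `lam`. -/
def JuliaCondition (B : ℂ → D →L[ℂ] ℂ) (lam : ℂ) : Prop :=
  Filter.liminf (fun z : ℂ => (((1 - ‖B z‖) / (1 - ‖z‖) : ℝ) : EReal))
    (nhdsWithin lam (Metric.ball 0 1)) < ⊤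

theorem JuliaCondition.exists_frequently (h : JuliaCondition B lam) :
    ∃ C : ℝ, ∃ᶠ z in 𝓝[Metric.ball 0 1] lam, (1 - ‖B z‖) / (1 - ‖z‖) < C := by
  obtain ⟨C, hC, -⟩ := EReal.lt_iff_exists_real_btwn.1 h
  exact ⟨C, (frequently_lt_of_liminf_lt (by isBoundedDefault) hC).mono
    fun z hz => EReal.coe_lt_coe_iff.1 hz⟩

theorem juliaCondition_of_frequently {C : ℝ}
    (h : ∃ᶠ z in 𝓝[Metric.ball 0 1] lam, (1 - ‖B z‖) / (1 - ‖z‖) ≤ C) : JuliaCondition B lam :=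
  (liminf_le_of_frequently_le' (h.mono fun _ hz => EReal.coe_le_coe_iff.2 hz)).trans_lt
    (EReal.coe_lt_top C)

theorem IsSchur.norm_apply_le (hB : IsSchur B) {z : ℂ} (hz : ‖z‖ < 1) : ‖B z‖ ≤ 1 :=
  hB.contractive z (by simpa using hz)

/-- Boundedness of the difference quotient of `B b` along the radius bounds the Julia quotient. -/
theorem juliaCondition_of_radial (hlam : ‖lam‖ = 1) {b : D} (hb : ‖b‖ ≤ 1)
    {C : ℝ} (h : ∃ᶠ r : ℝ in 𝓝[<] 1, ‖1 - B (r * lam) b‖ ≤ C * (1 - r)) :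
    JuliaCondition B lam := by
  refine juliaCondition_of_frequently (C := C) ((tendsto_radius_ball hlam).frequently ?_)
  refine (h.and_eventually (Ioo_mem_nhdsLT (show (0 : ℝ) < 1 by norm_num))).mono ?_
  rintro r ⟨hr, hr0, hr1⟩
  have h1 : ‖(r : ℂ) * lam‖ = r := by simp [hlam, abs_of_pos hr0]
  rw [h1, div_le_iff₀ (by linarith)]
  refine le_trans ?_ hr
  have h2 : ‖B (r * lam) b‖ ≤ ‖B (r * lam)‖ :=
    ((B (r * lam)).le_opNorm b).trans (mul_le_of_le_one_right (norm_nonneg _) hb)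
  have h3 := norm_sub_norm_le (1 : ℂ) (B (r * lam) b)
  rw [norm_one] at h3
  linarith

variable [CompleteSpace D]

/-- The two sides differ by the factor (1 + ‖B w‖) / (1 + ‖w‖), which lies between 1/2 and 2; the
same remark gives the reverse estimate below. -/
theorem IsSchur.norm_kernel_sq_le (hB : IsSchur B) {w : ℂ} (hw : ‖w‖ < 1) :
    ‖hB.kernel w‖ ^ 2 ≤ 2 * ((1 - ‖B w‖) / (1 - ‖w‖)) := by
  have h1 := hB.norm_apply_le hw
  have h2 := norm_nonneg (B w)
  have h3 := norm_nonneg w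
  rw [hB.norm_kernel_sq hw, mul_div_assoc', div_le_div_iff₀ (by nlinarith) (by linarith)]
  have h4 := mul_nonneg (sub_nonneg.2 h1) (sub_nonneg.2 hw.le)
  nlinarith [mul_nonneg h4 h3, mul_nonneg h4 (sub_nonneg.2 h1)]

theorem IsSchur.quotient_le_norm_kernel_sq (hB : IsSchur B) {w : ℂ} (hw : ‖w‖ < 1) :
    (1 - ‖B w‖) / (1 - ‖w‖) ≤ 2 * ‖hB.kernel w‖ ^ 2 := by
  have h1 := hB.norm_apply_le hw
  have h2 := norm_nonneg (B w)
  have h3 := norm_nonneg w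
  rw [hB.norm_kernel_sq hw, mul_div_assoc', div_le_div_iff₀ (by linarith) (by nlinarith)]
  have h4 := mul_nonneg (sub_nonneg.2 h1) (sub_nonneg.2 hw.le)
  nlinarith [mul_nonneg h4 h2, mul_nonneg h4 (sub_nonneg.2 hw.le)]

/-- A weak limit of unit-ball vectors could lose norm. But |1 - B(rλ)b| ≥ 1 - ‖b‖, while
Cauchy–Schwarz and ‖k_{rλ}‖² (1 - r) ≤ 1 bound the left side by √(1 - r) ‖u‖, which tends to 0. -/
theorem IsSchur.norm_eq_one_of_quotient_eq (hB : IsSchur B) (hlam : ‖lam‖ = 1) {b : D}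
    (hb : ‖b‖ ≤ 1) {u : Hardy ℂ}
    (hu : ∀ z : ℂ, ‖z‖ < 1 → ⟪hB.kernel z, u⟫_ℂ = (1 - B z b) / (1 - z * starRingEnd ℂ lam)) :
    ‖b‖ = 1 := by
  refine le_antisymm hb (not_lt.1 fun hlt => ?_)
  have key : ∀ᶠ r : ℝ in 𝓝[<] 1, (1 - ‖b‖) ^ 2 ≤ (1 - r) * ‖u‖ ^ 2 := by
    filter_upwards [Ioo_mem_nhdsLT (show (0 : ℝ) < 1 by norm_num)] with r hr
    have h1 : ‖(r : ℂ) * lam‖ = r := by simp [hlam, abs_of_pos hr.1]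
    have hr1 : 0 < 1 - r := by linarith [hr.2]
    have hz : ‖(r : ℂ) * lam‖ < 1 := h1.trans_lt hr.2
    have h2 := hu _ hz
    rw [one_sub_radius_mul_conj hlam, eq_div_iff (by exact_mod_cast hr1.ne')] at h2
    have h3 : ‖1 - B (r * lam) b‖ ≤ ‖hB.kernel (r * lam)‖ * ‖u‖ * (1 - r) := by
      rw [← h2, norm_mul, Complex.norm_real, Real.norm_of_nonneg hr1.le]
      exact mul_le_mul_of_nonneg_right (norm_inner_le_norm _ _) hr1.le
    have h4 : ‖B (r * lam) b‖ ≤ ‖b‖ :=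
      ((B (r * lam)).le_opNorm b).trans
        (mul_le_of_le_one_left (norm_nonneg _) (hB.norm_apply_le hz))
    have h5 := norm_sub_norm_le (1 : ℂ) (B (r * lam) b)
    rw [norm_one] at h5
    have h6 : ‖hB.kernel (r * lam)‖ ^ 2 * (1 - r) ≤ 1 := by
      rw [hB.norm_kernel_sq hz, h1, div_mul_eq_mul_div, div_le_one (by nlinarith [hr.1])]
      nlinarith [sq_nonneg ‖B (r * lam)‖, hr.1]
    calc (1 - ‖b‖) ^ 2 ≤ (‖hB.kernel (r * lam)‖ * ‖u‖ * (1 - r)) ^ 2 :=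
          pow_le_pow_left₀ (by linarith) (by linarith) 2
      _ = (‖hB.kernel (r * lam)‖ ^ 2 * (1 - r)) * ((1 - r) * ‖u‖ ^ 2) := by ring
      _ ≤ (1 - r) * ‖u‖ ^ 2 := mul_le_of_le_one_left (by positivity) h6
  have hlim : Tendsto (fun r : ℝ => (1 - r) * ‖u‖ ^ 2) (𝓝[<] 1) (𝓝 ((1 - 1) * ‖u‖ ^ 2)) := by
    refine (Continuous.tendsto ?_ 1).mono_left nhdsWithin_le_nhds
    fun_prop
  have := ge_of_tendsto hlim key
  nlinarith

theorem IsSchur.exists_quotient_memH (hB : IsSchur B) (hlam : ‖lam‖ = 1)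
    (h : JuliaCondition B lam) :
    ∃ ξ : D →L[ℂ] ℂ, ‖ξ‖ = 1 ∧
      hB.MemH fun z => (1 - mulStar B ξ z) / (1 - z * starRingEnd ℂ lam) := by
  obtain ⟨C, hC⟩ := h.exists_frequently
  have hne : NeBot (𝓝[Metric.ball 0 1] lam ⊓ 𝓟 {z | (1 - ‖B z‖) / (1 - ‖z‖) < C}) :=
    frequently_mem_iff_neBot.1 hC
  -- An ultrafilter that tends to `lam` and along which the Julia quotient stays below `C`; both k_w
  -- and B(w)* are bounded along it, so both have weak limits.
  set U : Ultrafilter ℂ :=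
    Ultrafilter.of (𝓝[Metric.ball 0 1] lam ⊓ 𝓟 {z | (1 - ‖B z‖) / (1 - ‖z‖) < C})
  have hU : (U : Filter ℂ) ≤ 𝓝[Metric.ball 0 1] lam ⊓ 𝓟 {z | (1 - ‖B z‖) / (1 - ‖z‖) < C} :=
    Ultrafilter.of_le _
  have hU1 : ∀ᶠ w in (U : Filter ℂ), ‖w‖ < 1 := by
    filter_upwards [hU (mem_inf_of_left self_mem_nhdsWithin)] with w hw
    simpa using hw
  have hU2 : Tendsto id (U : Filter ℂ) (𝓝 lam) := (hU.trans inf_le_left).trans nhdsWithin_le_nhds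
  have hk : ∀ᶠ w in (U : Filter ℂ), ‖hB.kernel w‖ ≤ √(2 * C) := by
    filter_upwards [hU1, hU (mem_inf_of_right (mem_principal_self _))] with w hw hwC
    refine Real.le_sqrt_of_sq_le ((hB.norm_kernel_sq_le hw).trans ?_)
    exact mul_le_mul_of_nonneg_left (le_of_lt hwC) zero_le_two
  obtain ⟨u, -, hu⟩ := exists_tendsto_inner_ultrafilter U hk
  obtain ⟨b, hb, hblim⟩ := exists_tendsto_inner_ultrafilter U (x := fun w => rep (B w)) (C := 1)
    (hU1.mono fun w hw => (norm_rep _).trans_le (hB.norm_apply_le hw))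
  have huz : ∀ z : ℂ, ‖z‖ < 1 →
      ⟪hB.kernel z, u⟫_ℂ = (1 - B z b) / (1 - z * starRingEnd ℂ lam) := by
    intro z hz
    have h1 : Tendsto (fun w => ⟪hB.kernel z, hB.kernel w⟫_ℂ) U (𝓝 ⟪hB.kernel z, u⟫_ℂ) := by
      simpa only [Function.comp_def, inner_conj_symm] using
        (Complex.continuous_conj.tendsto _).comp (hu (hB.kernel z))
    have h2 : Tendsto (fun w => B z (rep (B w))) U (𝓝 (B z b)) := by
      have := (Complex.continuous_conj.tendsto _).comp (hblim (rep (B z)))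
      simp only [Function.comp_def, inner_conj_symm] at this
      simpa only [inner_rep (B z)] using this
    have h3 : Tendsto (fun w : ℂ => 1 - z * starRingEnd ℂ w) U (𝓝 (1 - z * starRingEnd ℂ lam)) :=
      (tendsto_const_nhds.mul ((Complex.continuous_conj.tendsto _).comp hU2)).const_sub 1
    refine tendsto_nhds_unique (h1.congr' ?_)
      ((h2.const_sub 1).div h3 (one_sub_mul_conj_ne_zero hz hlam.le))
    filter_upwards [hU1] with w hw using hB.inner_kernel_kernel hz hw
  obtain ⟨ξ, rfl⟩ := rep_surjective b
  refine ⟨ξ, ?_, (hB.memH_iff _).2 ⟨u, fun z hz => (huz z hz).symm⟩⟩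
  rw [← norm_rep]
  exact hB.norm_eq_one_of_quotient_eq hlam hb huz

section
variable {b : D} {u : Hardy ℂ}

theorem IsSchur.norm_one_sub_le (hB : IsSchur B) (hlam : ‖lam‖ = 1)
    (hu : ∀ z : ℂ, ‖z‖ < 1 → ⟪hB.kernel z, u⟫_ℂ = (1 - B z b) / (1 - z * starRingEnd ℂ lam))
    {w : ℂ} (hw : ‖w‖ < 1) : ‖1 - B w b‖ ≤ ‖hB.kernel w‖ * ‖u‖ * ‖w - lam‖ := by
  have h := hu w hw
  rw [eq_div_iff (one_sub_mul_conj_ne_zero hw hlam.le)] at h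
  rw [← h, norm_mul, norm_one_sub_mul_conj hlam]
  exact mul_le_mul_of_nonneg_right (norm_inner_le_norm _ _) (norm_nonneg _)

/-- A self-improving estimate: ‖k_w‖² (1 - |w|) ≤ 2 (1 - ‖B w‖) ≤ 2 |1 - B(w)b| ≤ 2 ‖k_w‖ ‖u‖ α (1 -
|w|), after which one factor ‖k_w‖ cancels. -/
theorem IsSchur.norm_kernel_le_of_mem_approachRegion (hB : IsSchur B) (hlam : ‖lam‖ = 1)
    (hb : ‖b‖ = 1)
    (hu : ∀ z : ℂ, ‖z‖ < 1 → ⟪hB.kernel z, u⟫_ℂ = (1 - B z b) / (1 - z * starRingEnd ℂ lam))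
    {α : ℝ} {w : ℂ} (hw : w ∈ approachRegion α lam) : ‖hB.kernel w‖ ≤ 2 * α * ‖u‖ := by
  have hw1 : 0 < 1 - ‖w‖ := sub_pos.2 hw.1
  have h1 := hB.norm_one_sub_le hlam hu hw.1
  have h2 := norm_sub_norm_le (1 : ℂ) (B w b)
  rw [norm_one] at h2
  have h3 := (B w).le_opNorm b
  rw [hb, mul_one] at h3
  have h4 : ‖hB.kernel w‖ ^ 2 * (1 - ‖w‖) ≤ 2 * (1 - ‖B w‖) := by
    have := hB.norm_kernel_sq_le hw.1
    rwa [mul_div_assoc', le_div_iff₀ hw1] at this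
  have h5 : ‖hB.kernel w‖ * ‖u‖ * ‖w - lam‖ ≤ ‖hB.kernel w‖ * ‖u‖ * (α * (1 - ‖w‖)) :=
    mul_le_mul_of_nonneg_left hw.2.le (by positivity)
  have h6 : ‖hB.kernel w‖ ^ 2 ≤ ‖hB.kernel w‖ * (2 * α * ‖u‖) := by
    refine le_of_mul_le_mul_right (h4.trans ?_) hw1
    linarith
  rcases (norm_nonneg (hB.kernel w)).eq_or_lt with h0 | h0
  · rw [← h0]
    have : 0 < α := by
      by_contra hα
      nlinarith [hw.2, norm_nonneg (w - lam)]
    positivity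
  · exact le_of_mul_le_mul_left (by rwa [← sq]) h0

/-- Expanding the square gives ‖B(w)* - b‖² ≤ 2 - 2 Re B(w)b ≤ 2 |1 - B(w)b|, which is O(|w - λ|)
once the kernels are bounded. -/
theorem IsSchur.tendsto_rep (hB : IsSchur B) (hlam : ‖lam‖ = 1) (hb : ‖b‖ = 1)
    (hu : ∀ z : ℂ, ‖z‖ < 1 → ⟪hB.kernel z, u⟫_ℂ = (1 - B z b) / (1 - z * starRingEnd ℂ lam))
    (α : ℝ) : Tendsto (fun w => rep (B w)) (𝓝[approachRegion α lam] lam) (𝓝 b) := by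
  rw [tendsto_iff_norm_sub_tendsto_zero]
  have h0 : Tendsto (fun w => √(2 * (2 * α * ‖u‖ * ‖u‖ * ‖w - lam‖)))
      (𝓝[approachRegion α lam] lam) (𝓝 0) := by
    have : Continuous fun w => √(2 * (2 * α * ‖u‖ * ‖u‖ * ‖w - lam‖)) := by fun_prop
    simpa using (this.tendsto lam).mono_left nhdsWithin_le_nhds
  refine squeeze_zero' (Eventually.of_forall fun _ => norm_nonneg _) ?_ h0
  filter_upwards [self_mem_nhdsWithin] with w hw
  refine Real.le_sqrt_of_sq_le ?_
  have h1 := norm_sub_sq (𝕜 := ℂ) (rep (B w)) b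
  rw [inner_rep, norm_rep, hb] at h1
  have h2 := hB.norm_apply_le hw.1
  have h3 : 1 - RCLike.re (B w b) ≤ ‖1 - B w b‖ := by
    simpa using Complex.re_le_norm (1 - B w b)
  have h4 := hB.norm_one_sub_le hlam hu hw.1
  have h5 : ‖hB.kernel w‖ * ‖u‖ * ‖w - lam‖ ≤ 2 * α * ‖u‖ * ‖u‖ * ‖w - lam‖ := by
    gcongr
    exact hB.norm_kernel_le_of_mem_approachRegion hlam hb hu hw
  nlinarith [norm_nonneg (B w)]

theorem IsSchur.exists_nontangentialLimit (hB : IsSchur B) (hlam : ‖lam‖ = 1) (hb : ‖b‖ = 1)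
    (hu : ∀ z : ℂ, ‖z‖ < 1 → ⟪hB.kernel z, u⟫_ℂ = (1 - B z b) / (1 - z * starRingEnd ℂ lam))
    {f : ℂ → ℂ} (hf : hB.MemH f) : ∃ l : ℂ, HasNontangentialLimit f lam l := by
  obtain ⟨v, hv⟩ := (hB.memH_iff f).1 hf
  -- `K` consists of the vectors representing the zero function. The given `u` is determined only
  -- modulo `K`, whereas weak limits of kernels lie in `Kᗮ`; hence the passage to the component `u'`
  -- of `u` in `Kᗮ`.
  set K : Submodule ℂ (Hardy ℂ) := (Submodule.span ℂ (hB.kernel '' Metric.ball 0 1))ᗮ with hK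
  have hkK : ∀ z : ℂ, ‖z‖ < 1 → ∀ m ∈ K, ⟪hB.kernel z, m⟫_ℂ = 0 := fun z hz m hm =>
    (Submodule.mem_orthogonal _ _).1 hm _
      (Submodule.subset_span ⟨z, by simpa using hz, rfl⟩)
  set u' := u - K.starProjection u with hu'
  have hu'K : u' ∈ Kᗮ := K.sub_starProjection_mem_orthogonal u
  have hku' : ∀ z : ℂ, ‖z‖ < 1 → ⟪hB.kernel z, u'⟫_ℂ = ⟪hB.kernel z, u⟫_ℂ := fun z hz => by
    rw [hu', inner_sub_right, hkK z hz _ (K.starProjection_apply_mem u), sub_zero]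
  refine ⟨⟪u', v⟫_ℂ, fun α hα => ?_⟩
  have hreg : ∀ᶠ w in 𝓝[approachRegion α lam] lam, w ∈ approachRegion α lam :=
    self_mem_nhdsWithin
  suffices h : Tendsto (fun w => ⟪hB.kernel w, v⟫_ℂ) (𝓝[approachRegion α lam] lam)
      (𝓝 ⟪u', v⟫_ℂ) from
    h.congr' (hreg.mono fun w hw => (hv w hw.1).symm)
  -- Along each ultrafilter the bounded kernels have some weak limit `y`; it remains to see that `y`
  -- is always `u'`.
  refine tendsto_iff_ultrafilter _ _ _ |>.2 fun U hU => ?_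
  have hUreg : ∀ᶠ w in (U : Filter ℂ), w ∈ approachRegion α lam := hU hreg
  obtain ⟨y, -, hy⟩ := exists_tendsto_inner_ultrafilter U
    (hUreg.mono fun w hw => hB.norm_kernel_le_of_mem_approachRegion hlam hb hu hw)
  suffices h : y - u' = 0 by
    rw [← sub_eq_zero.1 h]
    exact hy v
  have hyK : y ∈ Kᗮ := by
    refine (Submodule.mem_orthogonal' _ _).2 fun m hm => ?_
    refine tendsto_nhds_unique (hy m) (tendsto_const_nhds.congr' ?_)
    filter_upwards [hUreg] with w hw using (hkK w hw.1 m hm).symm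
  -- The explicit formula for ⟪k_w, k_z⟫ passes to the limit since B(w)* → b. So `y - u'` is
  -- orthogonal to all kernels, that is, in `K`, as well as in `Kᗮ`.
  have hyu : ∀ z : ℂ, ‖z‖ < 1 → ⟪y, hB.kernel z⟫_ℂ = ⟪u', hB.kernel z⟫_ℂ := by
    intro z hz
    have h1 : Tendsto (fun w => B w (rep (B z))) U (𝓝 ⟪b, rep (B z)⟫_ℂ) := by
      simp only [← inner_rep]
      exact ((hB.tendsto_rep hlam hb hu α).mono_left hU).inner tendsto_const_nhds
    have h2 : Tendsto (fun w : ℂ => 1 - w * starRingEnd ℂ z) U (𝓝 (1 - lam * starRingEnd ℂ z)) :=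
      ((tendsto_id.mono_left (hU.trans nhdsWithin_le_nhds)).mul_const _).const_sub 1
    have h3 : 1 - lam * starRingEnd ℂ z ≠ 0 := by
      intro h
      apply one_sub_mul_conj_ne_zero hz hlam.le
      simpa [mul_comm] using congrArg (starRingEnd ℂ) h
    have h4 : ⟪y, hB.kernel z⟫_ℂ = (1 - ⟪b, rep (B z)⟫_ℂ) / (1 - lam * starRingEnd ℂ z) := by
      refine tendsto_nhds_unique ((hy _).congr' ?_) ((h1.const_sub 1).div h2 h3)
      filter_upwards [hUreg] with w hw using hB.inner_kernel_kernel hw.1 hz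
    rw [h4, ← inner_conj_symm u', hku' z hz, hu z hz, ← inner_rep, map_div₀, map_sub, map_one,
      inner_conj_symm, map_sub, map_one, map_mul, Complex.conj_conj, mul_comm lam]
  have hd : y - u' ∈ K := by
    have hspan : Submodule.span ℂ (hB.kernel '' Metric.ball 0 1) ≤ (ℂ ∙ (y - u'))ᗮ := by
      rw [Submodule.span_le]
      rintro _ ⟨z, hz, rfl⟩
      rw [SetLike.mem_coe, Submodule.mem_orthogonal_singleton_iff_inner_right, inner_sub_left,
        hyu z (by simpa using hz), sub_self]
    exact (Submodule.mem_orthogonal' _ _).2 fun m hm =>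
      Submodule.mem_orthogonal_singleton_iff_inner_right.1 (hspan hm)
  have := Submodule.inner_right_of_mem_orthogonal hd (Kᗮ.sub_mem hyK hu'K)
  exact inner_self_eq_zero.1 this

end

/-- Radial limits make the functionals ⟪k_{rλ}, ·⟫ pointwise bounded along a sequence r → 1, so
Banach–Steinhaus bounds the norms of the kernels. -/
theorem IsSchur.juliaCondition_of_nontangentialLimits (hB : IsSchur B) (hlam : ‖lam‖ = 1)
    (h : ∀ f : ℂ → ℂ, hB.MemH f → ∃ l : ℂ, HasNontangentialLimit f lam l) :
    JuliaCondition B lam := by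
  obtain ⟨r, -, hr, hrlim⟩ := exists_seq_strictMono_tendsto' (show (0 : ℝ) < 1 by norm_num)
  have hr1 : Tendsto r atTop (𝓝[<] 1) :=
    tendsto_nhdsWithin_iff.2 ⟨hrlim, Eventually.of_forall fun n => (hr n).2⟩
  have hw : ∀ n, ‖(r n : ℂ) * lam‖ < 1 := fun n => by
    simpa [hlam, abs_of_pos (hr n).1] using (hr n).2
  obtain ⟨C, hC⟩ := banach_steinhaus (g := fun n => innerSL ℂ (hB.kernel (r n * lam))) fun v => by
    obtain ⟨l, hl⟩ := h _ ((hB.memH_iff _).2 ⟨v, fun _ _ => rfl⟩)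
    have := ((hl 2 one_lt_two).comp (tendsto_radius_approachRegion hlam one_lt_two)).comp hr1
    obtain ⟨C, hC⟩ := (Metric.isBounded_range_of_tendsto _ this).exists_norm_le
    exact ⟨C, fun n => hC _ ⟨n, rfl⟩⟩
  refine juliaCondition_of_frequently (C := 2 * C ^ 2)
    (((tendsto_radius_ball hlam).comp hr1).frequently (Frequently.of_forall fun n => ?_))
  refine (hB.quotient_le_norm_kernel_sq (hw n)).trans ?_
  have := hC n
  rw [innerSL_apply_norm] at this
  have := pow_le_pow_left₀ (norm_nonneg _) this 2
  change 2 * ‖hB.kernel (r n * lam)‖ ^ 2 ≤ _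
  linarith

theorem juliaCondition_of_caratheodory (hlam : ‖lam‖ = 1)
    (h : CaratheodoryCondition B lam) : JuliaCondition B lam := by
  obtain ⟨ξ, hξ, l, hl⟩ := h
  have h1 := ((hl 2 one_lt_two).comp (tendsto_radius_approachRegion hlam one_lt_two)).norm
  refine juliaCondition_of_radial hlam ((norm_rep ξ).trans hξ).le (C := ‖l‖ + 1)
    (Eventually.frequently ?_)
  filter_upwards [h1.eventually_le_const (lt_add_one ‖l‖), self_mem_nhdsWithin] with r hr hr1
  have h2 : 0 < 1 - r := sub_pos.2 hr1
  simp only [Function.comp_apply, one_sub_radius_mul_conj hlam, norm_div, Complex.norm_real,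
    Real.norm_of_nonneg h2.le, mulStar_eq] at hr
  rwa [div_le_iff₀ h2] at hr

theorem IsSchur.tfae_julia_caratheodory (hB : IsSchur B) (hlam : ‖lam‖ = 1) :
    [JuliaCondition B lam,
      ∃ ξ : D →L[ℂ] ℂ, ‖ξ‖ = 1 ∧
        hB.MemH fun z => (1 - mulStar B ξ z) / (1 - z * starRingEnd ℂ lam),
      ∀ f : ℂ → ℂ, hB.MemH f → ∃ l : ℂ, HasNontangentialLimit f lam l,
      CaratheodoryCondition B lam].TFAE := by
  have key : ∀ ξ : D →L[ℂ] ℂ, ‖ξ‖ = 1 →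
      (hB.MemH fun z => (1 - mulStar B ξ z) / (1 - z * starRingEnd ℂ lam)) →
      ∀ f : ℂ → ℂ, hB.MemH f → ∃ l : ℂ, HasNontangentialLimit f lam l := by
    intro ξ hξ hmem f hf
    obtain ⟨u, hu⟩ := (hB.memH_iff _).1 hmem
    exact hB.exists_nontangentialLimit hlam ((norm_rep ξ).trans hξ)
      (fun z hz => (hu z hz).symm) hf
  tfae_have 1 → 2 := hB.exists_quotient_memH hlam
  tfae_have 2 → 3 := fun ⟨ξ, hξ, hmem⟩ => key ξ hξ hmem
  tfae_have 3 → 1 := hB.juliaCondition_of_nontangentialLimits hlam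
  -- The quotient is itself an element of H(B), so it has a non-tangential limit.
  tfae_have 2 → 4 := fun ⟨ξ, hξ, hmem⟩ => ⟨ξ, hξ, key ξ hξ hmem _ hmem⟩
  tfae_have 4 → 1 := juliaCondition_of_caratheodory hlam
  tfae_finish

end

/-! ### The Herglotz representation and the recovery of point masses. -/

section
open Filter Topology MeasureTheory Metric Complex

/-- The Schwarz integral formula on the unit disc. -/
theorem circleAverage_herglotzRieszKernel_smul_re {G : ℂ → ℂ} (hG : DiffContOnCl ℂ G (ball 0 1))
    {z : ℂ} (hz : z ∈ ball (0 : ℂ) 1) :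
    Real.circleAverage (fun ζ => herglotzRieszKernel 0 z ζ • ((G ζ).re : ℂ)) 0 1
      = G z - I * ((G 0).im : ℂ) := by
  have hcont : ContinuousOn G (sphere 0 1) :=
    hG.continuousOn_ball.mono sphere_subset_closedBall
  have hci : CircleIntegrable (fun ζ => (G ζ).re) 0 1 :=
    ContinuousOn.circleIntegrable zero_le_one (continuous_re.comp_continuousOn hcont)
  have hciC : CircleIntegrable (fun ζ => ((G ζ).re : ℂ)) 0 1 :=
    ContinuousOn.circleIntegrable zero_le_one
      (continuous_ofReal.comp_continuousOn (continuous_re.comp_continuousOn hcont))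
  -- `A` and `G` are analytic with equal real parts, so they differ by an imaginary constant, found
  -- at 0, where the kernel is 1 and `A` is real.
  set A : ℂ → ℂ := fun w =>
    Real.circleAverage (fun ζ => herglotzRieszKernel 0 w ζ • ((G ζ).re : ℂ)) 0 1
  have hre : ∀ w ∈ ball (0 : ℂ) 1, (A w - G w).re = 0 := by
    intro w hw
    have h1 := re_circleAverage_herglotzRieszKernel_smul hci hw
    have h2 := hG.circleAverage_re_herglotzRieszKernel_smul hw
    have h3 : CircleIntegrable ((re ∘ herglotzRieszKernel 0 w) • G) 0 1 := by
      refine ContinuousOn.circleIntegrable zero_le_one (ContinuousOn.smul ?_ hcont)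
      have := continuousOn_herglotzRieszKernel_sphere hw
      rw [abs_one] at this
      exact continuous_re.comp_continuousOn this
    have h4 := reCLM.circleAverage_comp_comm h3
    rw [h2] at h4
    rw [sub_re, h1, ← reCLM_apply (G w), ← h4, sub_eq_zero]
    congr 1
    ext ζ
    simp
  obtain ⟨c, hc⟩ := AnalyticOnNhd.eq_re_add_const_mul_I_of_re_eq_const
    ((analyticOnNhd_circleAverage_herglotzRieszKernel_smul hciC).sub
      (hG.differentiableOn.analyticOnNhd isOpen_ball)) hre isOpen_ball
    (isConnected_ball one_pos)
  have h0 : (A 0).im = 0 := by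
    have : A 0 = ((Real.circleAverage (fun ζ => (G ζ).re) 0 1 : ℝ) : ℂ) := by
      rw [← ofRealCLM_apply, ← ofRealCLM.circleAverage_comp_comm hci]
      refine Real.circleAverage_congr_sphere fun ζ hζ => ?_
      have hne : ζ ≠ 0 := by
        rintro rfl
        simp at hζ
      simp [herglotzRieszKernel_def, hne]
    rw [this, ofReal_im]
  replace hc : ∀ w ∈ ball (0 : ℂ) 1, A w - G w = ((0 : ℝ) : ℂ) + c * I := hc
  have hcim : c = -(G 0).im := by
    have := congrArg Complex.im (hc 0 (mem_ball_self one_pos))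
    rw [sub_im, h0] at this
    simpa using this.symm
  change A z = _
  rw [sub_eq_iff_eq_add.1 (hc z hz), hcim]
  push_cast
  ring

theorem continuous_herglotzKernel {z : ℂ} (hz : z ∈ ball (0 : ℂ) 1) :
    Continuous fun ζ : sphere (0 : ℂ) 1 => ((ζ : ℂ) + z) / ((ζ : ℂ) - z) := by
  refine Continuous.div (by fun_prop) (by fun_prop) fun ζ h => ?_
  have h1 : ‖(ζ : ℂ)‖ = 1 := norm_eq_of_mem_sphere ζ
  rw [sub_eq_zero.1 h] at h1
  simp [h1] at hz

/-- The measure is the image on the circle of Re G dθ / 2π, and the identity is the Schwarz formula.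
-/
theorem exists_finiteMeasure_of_diffContOnCl {G : ℂ → ℂ} (hG : DiffContOnCl ℂ G (ball 0 1))
    (hpos : ∀ ζ ∈ sphere (0 : ℂ) 1, 0 ≤ (G ζ).re) :
    ∃ μ : FiniteMeasure (sphere (0 : ℂ) 1), ∀ z ∈ ball (0 : ℂ) 1,
      ∫ ζ, ((ζ : ℂ) + z) / ((ζ : ℂ) - z) ∂(μ : Measure (sphere (0 : ℂ) 1))
        = G z - I * ((G 0).im : ℂ) := by
  have hmem : ∀ θ : ℝ, circleMap 0 1 θ ∈ sphere (0 : ℂ) 1 := fun θ =>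
    circleMap_mem_sphere 0 zero_le_one θ
  let p : ℝ → sphere (0 : ℂ) 1 := fun θ => ⟨circleMap 0 1 θ, hmem θ⟩
  have hp : Continuous p := (continuous_circleMap 0 1).subtype_mk _
  let d : ℝ → ℝ := fun θ => (2 * Real.pi)⁻¹ * (G (circleMap 0 1 θ)).re
  have hd0 : ∀ θ, 0 ≤ d θ := fun θ => mul_nonneg (by positivity) (hpos _ (hmem θ))
  have hdc : Continuous d := by
    refine continuous_const.mul (continuous_re.comp ?_)
    exact (hG.continuousOn_ball.mono sphere_subset_closedBall).comp_continuous
      (continuous_circleMap 0 1) hmem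
  let ρ := (volume.restrict (Set.Ioc 0 (2 * Real.pi))).withDensity fun θ => ENNReal.ofReal (d θ)
  have hρ : IsFiniteMeasure ρ := by
    refine isFiniteMeasure_withDensity_ofReal (Integrable.hasFiniteIntegral ?_)
    exact (intervalIntegrable_iff_integrableOn_Ioc_of_le (by positivity)).1
      (hdc.intervalIntegrable 0 (2 * Real.pi))
  refine ⟨⟨ρ.map p, inferInstance⟩, fun z hz => ?_⟩
  rw [← circleAverage_herglotzRieszKernel_smul_re hG hz, FiniteMeasure.toMeasure_mk,
    integral_map hp.aemeasurable (continuous_herglotzKernel hz).aestronglyMeasurable,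
    integral_withDensity_eq_integral_toReal_smul₀ (by fun_prop)
      (Eventually.of_forall fun _ => ENNReal.ofReal_lt_top),
    Real.circleAverage_def, intervalIntegral.integral_of_le (by positivity), ← integral_smul]
  refine integral_congr_ae (Eventually.of_forall fun θ => ?_)
  simp only [ENNReal.toReal_ofReal (hd0 θ), herglotzRieszKernel_def, sub_zero, p, d, real_smul,
    smul_eq_mul]
  push_cast
  ring

/-- The **Herglotz representation theorem**. -/
theorem exists_herglotz_measure {F : ℂ → ℂ} (hF : DifferentiableOn ℂ F (ball 0 1))
    (hpos : ∀ z ∈ ball (0 : ℂ) 1, 0 ≤ (F z).re) :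
    ∃ μ : Measure (sphere (0 : ℂ) 1), IsFiniteMeasure μ ∧ ∀ z ∈ ball (0 : ℂ) 1,
      F z = (∫ ζ, ((ζ : ℂ) + z) / ((ζ : ℂ) - z) ∂μ) + I * ((F 0).im : ℂ) := by
  obtain ⟨r, -, hr, hrlim⟩ := exists_seq_strictMono_tendsto' (show (0 : ℝ) < 1 by norm_num)
  have hmaps : ∀ n, Set.MapsTo (fun z : ℂ => (r n : ℂ) * z) (closedBall 0 1) (ball 0 1) := by
    intro n z hz
    have hz' : ‖z‖ ≤ 1 := by simpa using hz
    have : ‖(r n : ℂ) * z‖ < 1 := by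
      rw [norm_mul, norm_real, Real.norm_of_nonneg (hr n).1.le]
      nlinarith [(hr n).1, (hr n).2, norm_nonneg z]
    simpa using this
  have hex : ∀ n, ∃ μ : FiniteMeasure (sphere (0 : ℂ) 1), ∀ z ∈ ball (0 : ℂ) 1,
      ∫ ζ, ((ζ : ℂ) + z) / ((ζ : ℂ) - z) ∂(μ : Measure (sphere (0 : ℂ) 1))
        = F (r n * z) - I * ((F 0).im : ℂ) := by
    intro n
    -- The dilates of `F` are continuous up to the circle, so they have explicit measures; a weak
    -- limit of these represents `F`.
    have hd : DiffContOnCl ℂ (fun z => F (r n * z)) (ball 0 1) := by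
      refine DifferentiableOn.diffContOnCl ?_
      rw [closure_ball (0 : ℂ) one_ne_zero]
      exact hF.comp (by fun_prop) (hmaps n)
    obtain ⟨μ, hμ⟩ := exists_finiteMeasure_of_diffContOnCl hd
      fun ζ hζ => hpos _ (hmaps n (sphere_subset_closedBall hζ))
    exact ⟨μ, fun z hz => by simpa using hμ z hz⟩
  choose μ hμ using hex
  -- At z = 0 the kernel is 1, so all masses equal Re F(0); this puts the measures in one compact
  -- set.
  have hmass : ∀ n, (μ n).mass = (F 0).re.toNNReal := by
    intro n
    have h1 := hμ n 0 (mem_ball_self one_pos)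
    have h2 : ∀ ζ : sphere (0 : ℂ) 1, ((ζ : ℂ) + 0) / ((ζ : ℂ) - 0) = 1 := fun ζ => by
      rw [add_zero, sub_zero, div_self (ne_zero_of_mem_unit_sphere ζ)]
    simp only [h2, integral_const, mul_zero, measureReal_def] at h1
    have h3 := congrArg Complex.re h1
    rw [sub_re, re_mul_ofReal, I_re, zero_mul, sub_zero, real_smul, mul_one, ofReal_re] at h3
    rw [← h3]
    exact (Real.toNNReal_coe (r := (μ n).mass)).symm
  let U : Ultrafilter ℕ := hyperfilter ℕ
  have hU : (U : Filter ℕ) ≤ atTop := Nat.hyperfilter_le_atTop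
  obtain ⟨ν, -, hν⟩ := (isCompact_setOfPred_finiteMeasure_eq_of_compactSpace
    (sphere (0 : ℂ) 1) (F 0).re.toNNReal).ultrafilter_le_nhds (U.map μ) (by
      rw [le_principal_iff, Ultrafilter.coe_map, mem_map]
      exact Eventually.of_forall hmass)
  refine ⟨ν, inferInstance, fun z hz => ?_⟩
  rw [← sub_eq_iff_eq_add]
  have h1 := (FiniteMeasure.tendsto_iff_forall_integral_rclike_tendsto ℂ).1
    (show Tendsto μ U (𝓝 ν) from hν)
    (BoundedContinuousFunction.mkOfCompact ⟨_, continuous_herglotzKernel hz⟩)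
  have h2 : Tendsto (fun n => F (r n * z) - I * ((F 0).im : ℂ)) U
      (𝓝 (F z - I * ((F 0).im : ℂ))) := by
    refine Tendsto.sub_const ?_ _
    have h3 : Tendsto (fun n => (r n : ℂ) * z) U (𝓝 z) := by
      have := ((continuous_ofReal.tendsto 1).comp (hrlim.mono_left hU)).mul_const z
      simpa using this
    exact ((hF.continuousOn.continuousAt (isOpen_ball.mem_nhds hz)).tendsto).comp h3
  refine tendsto_nhds_unique h2 (h1.congr fun n => ?_)
  exact hμ n z hz

/-- The point mass at `lam` is recovered from the Herglotz integral along the radius. -/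
theorem tendsto_one_sub_mul_herglotz_integral (μ : Measure (sphere (0 : ℂ) 1)) [IsFiniteMeasure μ]
    (lam : sphere (0 : ℂ) 1) :
    Tendsto (fun r : ℝ => ((1 - r : ℝ) : ℂ) *
        ∫ ζ, ((ζ : ℂ) + r * lam) / ((ζ : ℂ) - r * lam) ∂μ) (𝓝[<] 1)
      (𝓝 (2 * μ.real {lam} : ℂ)) := by
  have hlam : ‖(lam : ℂ)‖ = 1 := norm_eq_of_mem_sphere lam
  have hind : ∫ ζ, ({lam} : Set (sphere (0 : ℂ) 1)).indicator (fun _ => (2 : ℂ)) ζ ∂μ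
      = (2 * μ.real {lam} : ℂ) := by
    rw [integral_indicator_const _ (measurableSet_singleton lam), real_smul, mul_comm]
  have hr01 : ∀ᶠ r : ℝ in 𝓝[<] 1, r ∈ Set.Ioo (0 : ℝ) 1 :=
    Ioo_mem_nhdsLT (show (0 : ℝ) < 1 by norm_num)
  have hball : ∀ r ∈ Set.Ioo (0 : ℝ) 1, (r * lam : ℂ) ∈ ball (0 : ℂ) 1 := fun r hr => by
    simpa [hlam, abs_of_pos hr.1] using hr.2
  simp_rw [← integral_const_mul]
  rw [← hind]
  -- The integrand is at most (1 - r)(1 + r)/(1 - r) ≤ 2 in modulus; it equals 1 + r at `lam` and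
  -- tends to 0 elsewhere.
  refine tendsto_integral_filter_of_dominated_convergence (fun _ => 2) ?_ ?_
    (integrable_const _) ?_
  · filter_upwards [hr01] with r hr
    exact (continuous_const.mul (continuous_herglotzKernel (hball r hr))).aestronglyMeasurable
  · filter_upwards [hr01] with r hr
    refine Eventually.of_forall fun ζ => ?_
    have hζ : ‖(ζ : ℂ)‖ = 1 := norm_eq_of_mem_sphere ζ
    have hrl : ‖(r * lam : ℂ)‖ = r := by simp [hlam, abs_of_pos hr.1]
    have h1 := norm_sub_norm_le (ζ : ℂ) (r * lam)
    have h2 := norm_add_le (ζ : ℂ) (r * lam)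
    rw [hζ, hrl] at h1 h2
    have h3 : 0 < 1 - r := sub_pos.2 hr.2
    rw [norm_mul, norm_real, Real.norm_of_nonneg h3.le, norm_div, mul_div_assoc',
      div_le_iff₀ (h3.trans_le h1)]
    nlinarith [norm_nonneg ((ζ : ℂ) + r * lam), hr.2]
  · refine Eventually.of_forall fun ζ => ?_
    by_cases hζ : ζ = lam
    · subst hζ
      rw [Set.indicator_of_mem (Set.mem_singleton _)]
      have h1 : Tendsto (fun r : ℝ => ((1 + r : ℝ) : ℂ)) (𝓝[<] 1) (𝓝 2) := by
        have : Continuous fun r : ℝ => ((1 + r : ℝ) : ℂ) := by fun_prop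
        convert (this.tendsto 1).mono_left nhdsWithin_le_nhds using 2
        norm_num
      refine h1.congr' ?_
      filter_upwards [hr01] with r hr
      have h2 : (1 : ℂ) - r ≠ 0 := by
        exact_mod_cast (sub_pos.2 hr.2).ne'
      have h3 : (ζ : ℂ) ≠ 0 := ne_zero_of_mem_unit_sphere ζ
      rw [show (ζ : ℂ) + r * ζ = (1 + r) * ζ by ring, show (ζ : ℂ) - r * ζ = (1 - r) * ζ by ring,
        mul_div_mul_right _ _ h3]
      push_cast
      rw [mul_div_cancel₀ _ h2]
    · rw [Set.indicator_of_notMem (Set.notMem_singleton_iff.2 hζ)]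
      have h2 : (ζ : ℂ) - ((1 : ℝ) : ℂ) * lam ≠ 0 := by
        rw [ofReal_one, one_mul, sub_ne_zero]
        exact fun h => hζ (Subtype.ext h)
      have h3 : ContinuousAt (fun r : ℝ => ((1 - r : ℝ) : ℂ) *
          (((ζ : ℂ) + r * lam) / ((ζ : ℂ) - r * lam))) 1 := by
        refine ContinuousAt.mul (by fun_prop) (ContinuousAt.div (by fun_prop) (by fun_prop) h2)
      simpa using h3.tendsto.mono_left nhdsWithin_le_nhds

end

/-! ### Aleksandrov–Clark measures and condition (v). -/

section
open Filter Topology MeasureTheory Metric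

variable {D : Type*} [NormedAddCommGroup D] [InnerProductSpace ℂ D] [CompleteSpace D]
  {B : ℂ → D →L[ℂ] ℂ} {ξ : D →L[ℂ] ℂ}

theorem IsSchur.norm_mulStar_le (hB : IsSchur B) (hξ : ‖ξ‖ = 1) {z : ℂ} (hz : ‖z‖ < 1) :
    ‖mulStar B ξ z‖ ≤ 1 := by
  rw [mulStar_eq]
  refine ((B z).le_opNorm _).trans ?_
  rw [norm_rep, hξ, mul_one]
  exact hB.norm_apply_le hz

theorem IsAleksandrovClark.tendsto_one_sub_mul_herglotz {μ : Measure (sphere (0 : ℂ) 1)}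
    (h : IsAleksandrovClark B ξ μ) (lam : sphere (0 : ℂ) 1) :
    Tendsto (fun r : ℝ => ((1 - r : ℝ) : ℂ) * herglotz B ξ (r * lam)) (𝓝[<] 1)
      (𝓝 (2 * μ.real {lam} : ℂ)) := by
  have := h.finite
  have hlam : ‖(lam : ℂ)‖ = 1 := norm_eq_of_mem_sphere lam
  have h1 : Tendsto (fun r : ℝ => ((1 - r : ℝ) : ℂ) * (Complex.I * ((herglotz B ξ 0).im : ℂ)))
      (𝓝[<] 1) (𝓝 0) := by
    have : Continuous fun r : ℝ =>
        ((1 - r : ℝ) : ℂ) * (Complex.I * ((herglotz B ξ 0).im : ℂ)) := by fun_prop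
    simpa using (this.tendsto 1).mono_left nhdsWithin_le_nhds
  have h2 := (tendsto_one_sub_mul_herglotz_integral μ lam).add h1
  rw [add_zero] at h2
  refine h2.congr' ?_
  filter_upwards [Ioo_mem_nhdsLT (show (0 : ℝ) < 1 by norm_num)] with r hr
  have hz : (r * lam : ℂ) ∈ ball (0 : ℂ) 1 := by simpa [hlam, abs_of_pos hr.1] using hr.2
  rw [← mul_add, ← h.representation _ hz]

/-- With mass m > 0 at λ, eventually m ≤ (1 - r) |H_ξ(rλ)| ≤ 2 (1 - r) / |1 - B(rλ)ξ*|, which bounds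
the difference quotient by 2/m. -/
theorem IsAleksandrovClark.juliaCondition {μ : Measure (sphere (0 : ℂ) 1)}
    (h : IsAleksandrovClark B ξ μ) (hB : IsSchur B) (hξ : ‖ξ‖ = 1) {lam : sphere (0 : ℂ) 1}
    (hμ : μ {lam} ≠ 0) : JuliaCondition B lam := by
  have := h.finite
  have hlam : ‖(lam : ℂ)‖ = 1 := norm_eq_of_mem_sphere lam
  set m := μ.real {lam}
  have hm : 0 < m := ENNReal.toReal_pos hμ (measure_ne_top _ _)
  have h1 : Tendsto (fun r : ℝ => ‖((1 - r : ℝ) : ℂ) * herglotz B ξ (r * lam)‖) (𝓝[<] 1)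
      (𝓝 (2 * m)) := by
    have h2 : ‖(2 * m : ℂ)‖ = 2 * m := by simp [abs_of_pos hm]
    rw [← h2]
    exact (h.tendsto_one_sub_mul_herglotz lam).norm
  refine juliaCondition_of_radial hlam ((norm_rep ξ).trans hξ).le (C := 2 / m)
    (Eventually.frequently ?_)
  filter_upwards [h1.eventually_const_le (show m < 2 * m by linarith),
    Ioo_mem_nhdsLT (show (0 : ℝ) < 1 by norm_num)] with r hr hr01
  have hr1 : 0 < 1 - r := sub_pos.2 hr01.2
  have hz : ‖(r * lam : ℂ)‖ < 1 := by simpa [hlam, abs_of_pos hr01.1] using hr01.2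
  have hb : ‖B (r * lam) (rep ξ)‖ ≤ 1 := hB.norm_mulStar_le hξ hz
  have hne : 0 < ‖1 - B (r * lam) (rep ξ)‖ :=
    norm_pos_iff.2 (sub_ne_zero.2 (h.ne_one _ (by simpa using hz)).symm)
  have h2 := norm_add_le (1 : ℂ) (B (r * lam) (rep ξ))
  rw [norm_one] at h2
  rw [herglotz, mulStar_eq, norm_mul, norm_div, Complex.norm_real, Real.norm_of_nonneg hr1.le,
    mul_div_assoc', le_div_iff₀ hne] at hr
  rw [div_mul_eq_mul_div, le_div_iff₀ hm, mul_comm]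
  exact hr.trans (by nlinarith)

/-- By the maximum principle Bξ* is identically 1, and equality in Cauchy–Schwarz between a
contraction and a unit vector then identifies B(z) with ξ. -/
theorem IsSchur.eq_of_mulStar_eq_one (hB : IsSchur B) (hξ : ‖ξ‖ = 1) {z₀ : ℂ}
    (hz₀ : z₀ ∈ ball (0 : ℂ) 1) (h : mulStar B ξ z₀ = 1) : ∀ z ∈ ball (0 : ℂ) 1, B z = ξ := by
  have hb : ‖rep ξ‖ = 1 := (norm_rep ξ).trans hξ
  have hd : DifferentiableOn ℂ (mulStar B ξ) (ball 0 1) :=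
    hB.analytic.clm_apply (differentiableOn_const _)
  have hmax : IsMaxOn (norm ∘ mulStar B ξ) (ball 0 1) z₀ := fun z hz => by
    simpa [h] using hB.norm_mulStar_le hξ (by simpa using hz)
  have hconst := Complex.eqOn_of_isPreconnected_of_isMaxOn_norm
    (convex_ball (0 : ℂ) 1).isPreconnected isOpen_ball hd hz₀ hmax
  intro z hz
  have h1 : B z (rep ξ) = 1 := (hconst hz).trans h
  have h2 := norm_sub_sq (𝕜 := ℂ) (rep (B z)) (rep ξ)
  rw [inner_rep, h1, norm_rep (B z), hb] at h2
  have h3 := hB.contractive z hz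
  have h4 : ‖rep (B z) - rep ξ‖ ^ 2 ≤ 0 := by
    rw [h2]
    simp
    nlinarith [norm_nonneg (B z)]
  have h5 : rep (B z) = rep ξ :=
    sub_eq_zero.1 (norm_eq_zero.1 (pow_eq_zero_iff two_ne_zero |>.1
      (le_antisymm h4 (by positivity))))
  ext x
  rw [← inner_rep, h5, inner_rep]

theorem IsSchur.exists_isAleksandrovClark (hB : IsSchur B) (hξ : ‖ξ‖ = 1)
    (hne : ∀ z ∈ ball (0 : ℂ) 1, mulStar B ξ z ≠ 1) :
    ∃ μ : Measure (sphere (0 : ℂ) 1), IsAleksandrovClark B ξ μ := by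
  have hd : DifferentiableOn ℂ (mulStar B ξ) (ball 0 1) :=
    hB.analytic.clm_apply (differentiableOn_const _)
  have hdH : DifferentiableOn ℂ (herglotz B ξ) (ball 0 1) :=
    (hd.const_add 1).div (hd.const_sub 1) fun z hz => sub_ne_zero.2 (hne z hz).symm
  have hpos : ∀ z ∈ ball (0 : ℂ) 1, 0 ≤ (herglotz B ξ z).re := by
    intro z hz
    have hle : ‖mulStar B ξ z‖ ≤ 1 := hB.norm_mulStar_le hξ (by simpa using hz)
    have h1 : Complex.normSq (mulStar B ξ z) ≤ 1 := by
      rw [Complex.normSq_eq_norm_sq]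
      exact pow_le_one₀ (norm_nonneg _) hle
    rw [Complex.normSq_apply] at h1
    rw [herglotz, Complex.div_re, ← add_div]
    refine div_nonneg ?_ (Complex.normSq_nonneg _)
    simp
    nlinarith
  obtain ⟨μ, hfin, hμ⟩ := exists_herglotz_measure hdH hpos
  exact ⟨μ, hfin, hne, hμ⟩

/-- The quotient times (1 - r) H_ξ(rλ) is 1 + B(rλ)ξ*. A finite limit `l` forces Bξ* → 1, so l · 2
μ({λ}) = 2. -/
theorem IsAleksandrovClark.ne_zero_of_quotient {μ : Measure (sphere (0 : ℂ) 1)}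
    (h : IsAleksandrovClark B ξ μ) {lam : sphere (0 : ℂ) 1} {l : ℂ}
    (hl : HasNontangentialLimit
      (fun z => (1 - mulStar B ξ z) / (1 - z * starRingEnd ℂ (lam : ℂ))) lam l) :
    μ {lam} ≠ 0 := by
  have hlam : ‖(lam : ℂ)‖ = 1 := norm_eq_of_mem_sphere lam
  have h1 := (hl 2 one_lt_two).comp (tendsto_radius_approachRegion hlam one_lt_two)
  simp only [Function.comp_def, one_sub_radius_mul_conj hlam] at h1
  have hr01 : ∀ᶠ r : ℝ in 𝓝[<] 1, r ∈ Set.Ioo (0 : ℝ) 1 :=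
    Ioo_mem_nhdsLT (show (0 : ℝ) < 1 by norm_num)
  have hsub : Tendsto (fun r : ℝ => ((1 - r : ℝ) : ℂ)) (𝓝[<] 1) (𝓝 0) := by
    have : Continuous fun r : ℝ => ((1 - r : ℝ) : ℂ) := by fun_prop
    simpa using (this.tendsto 1).mono_left nhdsWithin_le_nhds
  have hone : Tendsto (fun r : ℝ => 1 - mulStar B ξ (r * lam)) (𝓝[<] 1) (𝓝 0) := by
    have h2 := hsub.mul h1
    rw [zero_mul] at h2
    refine h2.congr' ?_
    filter_upwards [hr01] with r hr
    exact mul_div_cancel₀ _ (by exact_mod_cast (sub_pos.2 hr.2).ne')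
  have h3 := h1.mul (h.tendsto_one_sub_mul_herglotz lam)
  have h4 : Tendsto (fun r : ℝ => 2 - (1 - mulStar B ξ (r * lam))) (𝓝[<] 1) (𝓝 (2 - 0)) :=
    hone.const_sub 2
  have h5 : l * (2 * μ.real {lam}) = 2 - 0 := by
    refine tendsto_nhds_unique h3 (h4.congr' ?_)
    filter_upwards [hr01] with r hr
    have hr1 : ((1 - r : ℝ) : ℂ) ≠ 0 := by exact_mod_cast (sub_pos.2 hr.2).ne'
    have hne : 1 - mulStar B ξ (r * lam) ≠ 0 :=
      sub_ne_zero.2 (h.ne_one _ (by simpa [hlam, abs_of_pos hr.1] using hr.2)).symm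
    rw [herglotz]
    field_simp
    ring
  intro h0
  simp [measureReal_def, h0] at h5

end

end Schur

theorem mainTheorem5 {D : Type*} [NormedAddCommGroup D] [InnerProductSpace ℂ D] [CompleteSpace D]
    [TopologicalSpace.SeparableSpace D] (B : ℂ → D →L[ℂ] ℂ) (hB : Schur.IsSchur B)
    (lam : Metric.sphere (0 : ℂ) 1) :
    [
      Filter.liminf (fun z : ℂ => (((1 - ‖B z‖) / (1 - ‖z‖) : ℝ) : EReal))
        (nhdsWithin (lam : ℂ) (Metric.ball 0 1)) < ⊤,
      ∃ ξ : D →L[ℂ] ℂ, ‖ξ‖ = 1 ∧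
        hB.MemH fun z => (1 - Schur.mulStar B ξ z) / (1 - z * starRingEnd ℂ (lam : ℂ)),
      ∀ f : ℂ → ℂ, hB.MemH f → ∃ l : ℂ, Schur.HasNontangentialLimit f lam l,
      Schur.CaratheodoryCondition B lam ].TFAE ∧
    -- all five conditions are equivalent unless `B` is a constant of norm one
    ((¬ ∃ ξ : D →L[ℂ] ℂ, ‖ξ‖ = 1 ∧ ∀ z ∈ Metric.ball (0 : ℂ) 1, B z = ξ) →
      (Schur.CaratheodoryCondition B lam ↔
        ∃ ξ : D →L[ℂ] ℂ, ‖ξ‖ = 1 ∧ ∃ μ : MeasureTheory.Measure (Metric.sphere (0 : ℂ) 1),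
          Schur.IsAleksandrovClark B ξ μ ∧ μ {lam} ≠ 0)) := by
  have htfae := hB.tfae_julia_caratheodory (norm_eq_of_mem_sphere lam)
  refine ⟨htfae, fun hconst => ⟨?_, ?_⟩⟩
  · rintro ⟨ξ, hξ, l, hl⟩
    -- The non-constancy of `B` enters only here, to make H_ξ finite on the disc; the ξ of the
    -- Carathéodory condition then serves for the measure.
    have hne : ∀ z ∈ Metric.ball (0 : ℂ) 1, Schur.mulStar B ξ z ≠ 1 := fun z hz h =>
      hconst ⟨ξ, hξ, hB.eq_of_mulStar_eq_one hξ hz h⟩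
    obtain ⟨μ, hμ⟩ := hB.exists_isAleksandrovClark hξ hne
    exact ⟨ξ, hξ, μ, hμ, hμ.ne_zero_of_quotient hl⟩
  · rintro ⟨ξ, hξ, μ, hμ, hmass⟩
    exact (htfae.out 0 3).1 (hμ.juliaCondition hB hξ hmass)
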